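/- **Setting.** Let $f\in\mathbb C\{x_1,x_2\}[z]$ be an irreducible quasi-ordinary polynomial of degree $n$ (a Weierstrass polynomial whose discriminant is a monomial in $x_1,x_2$ times a unit), let $\zeta=\sum\beta_\lambda x^\lambda\in\mathbb C\{x_1^{1/n},x_2^{1/n}\}$ be a root of $f$ with characteristic exponents $\lambda_1\le\dots\le\lambda_g$ ($g\ge1$). That is, $0\ne\lambda_j\in\mathbb Q^2_{\ge0}$ and, with $\lambda_0=0$, $\lambda_{g+1}=\infty$, $M_0=\mathbb Z^2$, $M_j=M_{j-1}+\mathbb Z\lambda_j$ and coordinatewise order: $\beta_{\lambda_j}\neq0$; $\lambda_j\notin M_{j-1}$; and if $\beta_\lambda\ne0$, $\lambda_j\le\lambda$ and $\lambda_{j+1}\not\le\lambda$, then $\lambda\in M_j$. Assume $(\lambda_1^{(1)},\dots,\lambda_g^{(1)})\ge_{\rm lex}(\lambda_1^{(2)},\dots,\lambda_g^{(2)})$ and that $\lambda_1$ is not of the form $(a,0)$ with $a<1$. Let $X=X^{(g)}=\{f=0\}$. For $0\le j\le g$ let $X^{(j)}=\{f_j=0\}$, where $f_j\in\mathbb C\{x_1,x_2\}[z]$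 is the monic irreducible polynomial with root $\zeta_j=\sum_{\lambda\not\ge\lambda_{j+1}}\beta_\lambda x^\lambda$ ($\zeta_g=\zeta$, $f_g=f$; $f_0=z-\zeta_0$, which is $z$ if all exponents of $\zeta$ are $\ge\lambda_1$). **Numerical data.** Put $n_0=1$, $n_j=[M_j:M_{j-1}]$, $e_j=n_{j+1}\cdots n_g$, $\gamma_0=0$, $\gamma_1=\lambda_1$, $\gamma_{j+1}=n_j\gamma_j+\lambda_{j+1}-\lambda_j$. For $\nu\in\mathbb Z_{\ge0}^2$ put $l_0(\nu)=0$, $l_i(\nu)=n_ie_i\langle\nu,\gamma_i\rangle$ $(1\le i\le g)$, $l_{g+1}(\nu)=\infty$. Let $N_i$ be the dual lattice of $M_i$. Let $i(\nu)=g+1$ if $\nu\in N_g$, and $i(\nu)=\min\{1\le i\le g:\nu\notin N_i\}$ otherwise; let $m(\nu)=\min\{1\le i\le g: n_i\langle\nu,\gamma_i\rangle<\langle\nu,\gamma_{i+1}\rangle\}$, with $\gamma_{g+1}=\infty$. Let $\sigma_{Sing}$ be the union of the relative interiors of the faces of $\sigma=\mathbb R_{\ge0}^2$ whose torus orbits in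 the (toric) normalization of $X$ lie over the singular locus; that is, $\nu\in\sigma_{Sing}$ iff all points of $X$ near $0$ with ($x_k=0\Leftrightarrow\nu_k>0$, $k=1,2$) are singular. For $m\in\mathbb Z_{>0}$ let $$H_m=\{\nu\in[0,m]^2\cap\sigma_{Sing}\cap\mathbb Z^2:\ l_{m(\nu)}(\nu)\ge m+1\},\qquad L_m=\{\nu\in[0,m]^2\cap\sigma_{Sing}\cap N_1:\ l_{m(\nu)}(\nu)\le m<l_{i(\nu)}(\nu)\}.$$ **Jets.** Jets are jets of germs at the origin: for a small $r>0$ we consider only jets centred at points with $|x_1|,|x_2|<r$. Let $\mathbb A^3_m$ be the space of $m$-jets of affine three-space and $\pi^a_{q,p}:\mathbb A^3_q\to\mathbb A^3_p$ ($q\ge p$) the truncation. Let $X^{(j)}_m\subset\mathbb A^3_m$ be the set of $m$-jets $\gamma$ with $f_j\circ\gamma\equiv0$ mod $t^{m+1}$, and $$D^\nu_{j,m}=\{\gamma\in X_m^{(j)}:\ \mathrm{ord}_t(x_k\circ\gamma)=\nu_k,\ k=1,2\},\qquad D_m^\nu=D_{g,m}^\nu .$$ **Proposition.** There is $r_0>0$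 such that for every $0<r\le r_0$, every $m\in\mathbb Z_{>0}$ and every $\nu\in H_m\cup L_m$ the following holds. There is exactly one integer $j=j(m,\nu)\in\{0,\dots,i(\nu)-1\}$ with $l_j(\nu)\le m<l_{j+1}(\nu)$, and for this $j$ $$D_m^\nu=\{\gamma\in\mathbb A^3_m:\ \mathrm{ord}_t(x_k\circ\gamma)=\nu_k,\ k=1,2\}\cap\big(\pi^a_{m,[m/e_j]}\big)^{-1}\big(X^{(j)}_{[m/e_j]}\big).$$ If moreover $\nu_1,\nu_2\le[m/e_j]$, then $$D_m^\nu=\big(\pi^a_{m,[m/e_j]}\big)^{-1}\big(D^\nu_{j,[m/e_j]}\big).$$ -/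

import Mathlib

noncomputable section

namespace QOJets

/-! ### The ring `ℂ{x₁, x₂}` of convergent power series and evaluation -/

/-- A power series in two variables is convergent if it converges absolutely on some polydisc
of positive radius around the origin. -/
def IsConvergent (φ : MvPowerSeries (Fin 2) ℂ) : Prop :=
  ∃ r : ℝ, 0 < r ∧ Summable fun a : Fin 2 →₀ ℕ => ‖MvPowerSeries.coeff a φ‖ * r ^ a.degree

theorem isConvergent_mono {φ : MvPowerSeries (Fin 2) ℂ} {r s : ℝ} (hs : 0 < s) (hsr : s ≤ r)
    (h : Summable fun a : Fin 2 →₀ ℕ => ‖MvPowerSeries.coeff a φ‖ * r ^ a.degree) :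
    Summable fun a : Fin 2 →₀ ℕ => ‖MvPowerSeries.coeff a φ‖ * s ^ a.degree :=
  Summable.of_nonneg_of_le (fun a => by positivity) (fun a => by gcongr) h

theorem isConvergent_add {φ ψ : MvPowerSeries (Fin 2) ℂ} (hφ : IsConvergent φ)
    (hψ : IsConvergent ψ) : IsConvergent (φ + ψ) := by
  obtain ⟨r, hr, h⟩ := hφ
  obtain ⟨s, hs, h'⟩ := hψ
  have hm : 0 < min r s := lt_min hr hs
  refine ⟨min r s, hm, ?_⟩
  refine Summable.of_nonneg_of_le (fun a => by positivity) (fun a => ?_)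
    ((isConvergent_mono hm (min_le_left _ _) h).add (isConvergent_mono hm (min_le_right _ _) h'))
  rw [map_add, ← add_mul]
  gcongr
  exact norm_add_le _ _

theorem isConvergent_mul {φ ψ : MvPowerSeries (Fin 2) ℂ} (hφ : IsConvergent φ)
    (hψ : IsConvergent ψ) : IsConvergent (φ * ψ) := by
  obtain ⟨r, hr, h⟩ := hφ
  obtain ⟨s, hs, h'⟩ := hψ
  have hm : 0 < min r s := lt_min hr hs
  have h₁ := isConvergent_mono hm (min_le_left _ _) h
  have h₂ := isConvergent_mono hm (min_le_right _ _) h'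
  refine ⟨min r s, hm, ?_⟩
  generalize min r s = q at *
  have key := summable_sum_mul_antidiagonal_of_summable_mul
    (f := fun a : Fin 2 →₀ ℕ => ‖MvPowerSeries.coeff a φ‖ * q ^ a.degree)
    (g := fun a : Fin 2 →₀ ℕ => ‖MvPowerSeries.coeff a ψ‖ * q ^ a.degree)
    (h₁.mul_of_nonneg h₂ (fun a => by positivity) (fun a => by positivity))
  refine Summable.of_nonneg_of_le (fun a => by positivity) (fun a => ?_) key
  rw [MvPowerSeries.coeff_mul]
  calc ‖∑ p ∈ Finset.HasAntidiagonal.antidiagonal a,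
          MvPowerSeries.coeff p.1 φ * MvPowerSeries.coeff p.2 ψ‖ * q ^ a.degree
      ≤ (∑ p ∈ Finset.HasAntidiagonal.antidiagonal a,
          ‖MvPowerSeries.coeff p.1 φ‖ * ‖MvPowerSeries.coeff p.2 ψ‖) * q ^ a.degree := by
        gcongr
        refine (norm_sum_le _ _).trans (Finset.sum_le_sum fun p _ => ?_)
        exact (norm_mul _ _).le
    _ = _ := by
        rw [Finset.sum_mul]
        refine Finset.sum_congr rfl fun p hp => ?_
        rw [← Finset.HasAntidiagonal.mem_antidiagonal.mp hp, map_add, pow_add]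
        ring

theorem isConvergent_C (c : ℂ) : IsConvergent (MvPowerSeries.C c) := by
  classical
  refine ⟨1, one_pos, summable_of_ne_finset_zero (s := {0}) fun a ha => ?_⟩
  rw [MvPowerSeries.coeff_C, if_neg (by simpa using ha)]
  simp

/-- The ring `ℂ{x₁, x₂}` of convergent power series. -/
def ConvPS : Subalgebra ℂ (MvPowerSeries (Fin 2) ℂ) where
  carrier := {φ | IsConvergent φ}
  mul_mem' := isConvergent_mul
  add_mem' := isConvergent_add
  algebraMap_mem' c := isConvergent_C c

/-- The value of a convergent power series at the point `(x 0, x 1)` (meaningful inside its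
domain of convergence). -/
def evalPS (φ : ConvPS) (x : Fin 2 → ℂ) : ℂ :=
  ∑' a : Fin 2 →₀ ℕ, MvPowerSeries.coeff a φ.1 * (x 0 ^ a 0 * x 1 ^ a 1)

/-- The value at the point `(x₁, x₂, z) = (p 0, p 1, p 2)` of a polynomial in `ℂ{x₁, x₂}[z]`. -/
def evalPoly (f : Polynomial ConvPS) (p : Fin 3 → ℂ) : ℂ :=
  f.sum fun k c => evalPS c ![p 0, p 1] * p 2 ^ k

/-! ### Quasi-ordinary polynomials, branches and characteristic exponents -/

/-- Quasi-ordinary polynomials: Weierstrass polynomials in `ℂ{x₁, x₂}[z]` whose discriminant is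
a monomial times a unit. -/
structure IsQuasiOrdinary (f : Polynomial ConvPS) : Prop where
  monic : f.Monic
  weierstrass : ∀ k < f.natDegree, MvPowerSeries.constantCoeff (f.coeff k).1 = 0
  discr : ∃ (δ₁ δ₂ : ℕ) (ε : ConvPS), IsUnit ε ∧
    f.discr.1 = MvPowerSeries.X 0 ^ δ₁ * MvPowerSeries.X 1 ^ δ₂ * ε.1

/-- Elements of `ℂ{x₁^{1/n}, x₂^{1/n}}` are written as convergent power series in
`u_i = x_i^{1/n}`. This is the inclusion of `ℂ{x₁, x₂}`, sending `x_i` to `u_i ^ n`. -/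
def toFractional (n : ℕ) (hn : n ≠ 0) : ConvPS →+* MvPowerSeries (Fin 2) ℂ :=
  ((MvPowerSeries.expand n hn).comp ConvPS.val).toRingHom

/-- The fractional power series `ζ ∈ ℂ{x₁^{1/n}, x₂^{1/n}}` is a root of `f`. -/
def IsBranch (n : ℕ) (hn : n ≠ 0) (f : Polynomial ConvPS) (ζ : ConvPS) : Prop :=
  f.eval₂ (toFractional n hn) ζ.1 = 0

/-- The exponent in `ℚ²` of the monomial `u^a = x^{a/n}`. -/
def expo (n : ℕ) (a : Fin 2 →₀ ℕ) : Fin 2 → ℚ := fun k => (a k : ℚ) / n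

/-- The lattices `M_0 = ℤ²`, `M_j = M_{j-1} + ℤ λ_j`. -/
def latM (lam : ℕ → Fin 2 → ℚ) : ℕ → AddSubgroup (Fin 2 → ℚ)
  | 0 => ((Int.castAddHom ℚ).compLeft (Fin 2)).range
  | j + 1 => latM lam j ⊔ AddSubgroup.zmultiples (lam (j + 1))

/-- `λ_1, …, λ_g` are the characteristic exponents of the branch `ζ ∈ ℂ{x₁^{1/n}, x₂^{1/n}}`
(`≤` on `ℚ²` is coordinate-wise, `λ_0 = 0` and `λ_{g+1} = ∞`). -/
structure IsCharExponents (n : ℕ) (ζ : ConvPS) (g : ℕ) (lam : ℕ → Fin 2 → ℚ) : Prop where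
  zero : lam 0 = 0
  nonneg : ∀ j, 1 ≤ j → j ≤ g → 0 ≤ lam j
  ne_zero : ∀ j, 1 ≤ j → j ≤ g → lam j ≠ 0
  le_succ : ∀ j, 1 ≤ j → j < g → lam j ≤ lam (j + 1)
  coeff_ne_zero : ∀ j, 1 ≤ j → j ≤ g →
    ∃ a, expo n a = lam j ∧ MvPowerSeries.coeff a ζ.1 ≠ 0
  support : ∀ a, MvPowerSeries.coeff a ζ.1 ≠ 0 → ∀ j ≤ g,
    lam j ≤ expo n a → (j < g → ¬ lam (j + 1) ≤ expo n a) → expo n a ∈ latM lam j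
  notMem : ∀ j, 1 ≤ j → j ≤ g → lam j ∉ latM lam (j - 1)

/-- The truncation `ζ_j` of the branch `ζ`, as a formal power series in `u_i = x_i^{1/n}`: the
sum of all terms of `ζ` whose exponent `λ` does not satisfy `λ ≥ λ_{j+1}` if `j < g`, and
`ζ_g = ζ`. -/
def truncSeries (n : ℕ) (ζ : ConvPS) (g : ℕ) (lam : ℕ → Fin 2 → ℚ) (j : ℕ) :
    MvPowerSeries (Fin 2) ℂ :=
  open Classical in
  fun a => if j < g ∧ lam (j + 1) ≤ expo n a then 0 else MvPowerSeries.coeff a ζ.1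

open Classical in
theorem coeff_truncSeries (n : ℕ) (ζ : ConvPS) (g : ℕ) (lam : ℕ → Fin 2 → ℚ) (j : ℕ)
    (a : Fin 2 →₀ ℕ) : MvPowerSeries.coeff a (truncSeries n ζ g lam j) =
      if j < g ∧ lam (j + 1) ≤ expo n a then 0 else MvPowerSeries.coeff a ζ.1 :=
  rfl

theorem isConvergent_truncSeries (n : ℕ) (ζ : ConvPS) (g : ℕ) (lam : ℕ → Fin 2 → ℚ) (j : ℕ) :
    IsConvergent (truncSeries n ζ g lam j) := by
  obtain ⟨r, hr, h⟩ := ζ.2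
  refine ⟨r, hr, Summable.of_nonneg_of_le (fun a => by positivity) (fun a => ?_) h⟩
  refine mul_le_mul_of_nonneg_right ?_ (by positivity)
  rw [coeff_truncSeries]
  split_ifs
  · simp
  · exact le_rfl

/-- The truncation `ζ_j`, as a convergent series. -/
def truncBranch (n : ℕ) (ζ : ConvPS) (g : ℕ) (lam : ℕ → Fin 2 → ℚ) (j : ℕ) : ConvPS :=
  ⟨truncSeries n ζ g lam j, isConvergent_truncSeries n ζ g lam j⟩

/-- `p ∈ ℂ{x₁, x₂}[z]` is the defining polynomial of the hypersurface germ parametrized by the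
fractional power series `ξ`: it is monic and irreducible with root `ξ`. -/
structure IsDefiningPoly (n : ℕ) (hn : n ≠ 0) (ξ : ConvPS) (p : Polynomial ConvPS) : Prop where
  monic : p.Monic
  irreducible : Irreducible p
  root : IsBranch n hn p ξ

/-- The relabelling convention
`(λ_1^{(1)}, …, λ_g^{(1)}) ≥_lex (λ_1^{(2)}, …, λ_g^{(2)})`. -/
def LexOrdered (g : ℕ) (lam : ℕ → Fin 2 → ℚ) : Prop :=
  toLex (fun j : Fin g => lam (j + 1) 1) ≤ toLex (fun j : Fin g => lam (j + 1) 0)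

/-- `λ_1` is not of the form `(a, 0)` with `a < 1`. -/
def Normalized (lam : ℕ → Fin 2 → ℚ) : Prop := ¬ (lam 1 1 = 0 ∧ lam 1 0 < 1)

/-! ### Numerical data -/

/-- The indices `n_j = [M_j : M_{j-1}]`, with `n_0 = 1`. -/
def idx (lam : ℕ → Fin 2 → ℚ) (j : ℕ) : ℕ :=
  if j = 0 then 1 else (latM lam (j - 1)).relIndex (latM lam j)

/-- `e_j = n_{j+1} ⋯ n_g`. -/
def ee (g : ℕ) (lam : ℕ → Fin 2 → ℚ) (j : ℕ) : ℕ := ∏ i ∈ Finset.Ioc j g, idx lam i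

/-- The generators `γ_1 = λ_1`, `γ_{j+1} = n_j γ_j + λ_{j+1} - λ_j` of the semigroup
(with `γ_0 = 0`). -/
def gam (lam : ℕ → Fin 2 → ℚ) : ℕ → Fin 2 → ℚ
  | 0 => 0
  | j + 1 => idx lam j • gam lam j + (lam (j + 1) - lam j)

/-- The pairing `⟨ν, μ⟩`, for `ν ∈ σ ∩ N_0 = ℕ²`. -/
def pairing (ν : Fin 2 → ℕ) (μ : Fin 2 → ℚ) : ℚ := ∑ k, (ν k : ℚ) * μ k

/-- `ν` belongs to the lattice `N_i` dual to `M_i`. -/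
def InDual (lam : ℕ → Fin 2 → ℚ) (i : ℕ) (ν : Fin 2 → ℕ) : Prop :=
  ∀ μ ∈ latM lam i, ∃ k : ℤ, pairing ν μ = k

/-- `l_i(ν) = n_i e_i ⟨ν, γ_i⟩` for `1 ≤ i ≤ g`, `l_0(ν) = 0` and `l_{g+1}(ν) = ∞`. -/
def ell (g : ℕ) (lam : ℕ → Fin 2 → ℚ) (ν : Fin 2 → ℕ) (i : ℕ) : WithTop ℚ :=
  if i ≤ g then (((idx lam i : ℚ) * ee g lam i * pairing ν (gam lam i) : ℚ) : WithTop ℚ) else ⊤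

/-- `i(ν)`: equal to `g + 1` if `ν ∈ N_g`, and otherwise the least `i ∈ {1, …, g}` with
`ν ∉ N_i`. -/
def iIndex (g : ℕ) (lam : ℕ → Fin 2 → ℚ) (ν : Fin 2 → ℕ) : ℕ :=
  open Classical in
  if InDual lam g ν then g + 1 else sInf {i | 1 ≤ i ∧ i ≤ g ∧ ¬ InDual lam i ν}

/-- `m(ν)`: the least `i ∈ {1, …, g}` with `n_i ⟨ν, γ_i⟩ < ⟨ν, γ_{i+1}⟩`, where `γ_{g+1} = ∞`. -/
def mIndex (g : ℕ) (lam : ℕ → Fin 2 → ℚ) (ν : Fin 2 → ℕ) : ℕ :=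
  sInf {i | 1 ≤ i ∧ i ≤ g ∧
    (i < g → (idx lam i : ℚ) * pairing ν (gam lam i) < pairing ν (gam lam (i + 1)))}

/-- `j` is the integer `j(m, ν) ∈ {0, …, i(ν) - 1}`, defined by `l_j(ν) ≤ m < l_{j+1}(ν)`. -/
def IsLevel (g : ℕ) (lam : ℕ → Fin 2 → ℚ) (m : ℕ) (ν : Fin 2 → ℕ) (j : ℕ) : Prop :=
  j < iIndex g lam ν ∧ ell g lam ν j ≤ ((m : ℚ) : WithTop ℚ) ∧
    ((m : ℚ) : WithTop ℚ) < ell g lam ν (j + 1)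

/-- `ν ∈ σ_Sing`, for the surface germ `X = {f = 0}`. The orbit of the toric normalization
attached to the face of `σ` having `ν` in its relative interior maps onto the stratum
`{x_k = 0 ↔ ν_k > 0}` of `X`; it lies over the singular locus iff all points of `X` in this
stratum, near the origin, are singular, i.e. the differential of `f` vanishes there. -/
def InSigmaSing (f : Polynomial ConvPS) (ν : Fin 2 → ℕ) : Prop :=
  ∃ r : ℝ, 0 < r ∧ ∀ p : Fin 3 → ℂ, ‖p 0‖ < r → ‖p 1‖ < r → evalPoly f p = 0 →
    (p 0 = 0 ↔ 0 < ν 0) → (p 1 = 0 ↔ 0 < ν 1) → fderiv ℂ (evalPoly f) p = 0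

/-- The set `H_m`. -/
def setH (f : Polynomial ConvPS) (g : ℕ) (lam : ℕ → Fin 2 → ℚ) (m : ℕ) : Set (Fin 2 → ℕ) :=
  {ν | (∀ k, ν k ≤ m) ∧ InSigmaSing f ν ∧
    (((m + 1 : ℕ) : ℚ) : WithTop ℚ) ≤ ell g lam ν (mIndex g lam ν)}

/-- The set `L_m`. -/
def setL (f : Polynomial ConvPS) (g : ℕ) (lam : ℕ → Fin 2 → ℚ) (m : ℕ) : Set (Fin 2 → ℕ) :=
  {ν | (∀ k, ν k ≤ m) ∧ InSigmaSing f ν ∧ InDual lam 1 ν ∧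
    ell g lam ν (mIndex g lam ν) ≤ ((m : ℚ) : WithTop ℚ) ∧
    ((m : ℚ) : WithTop ℚ) < ell g lam ν (iIndex g lam ν)}

/-! ### Jets -/

/-- (Closed points of) the space `𝔸³_m` of `m`-jets of affine three-space:
`γ i l` is the coordinate `x_i^{(l)}`, `0 ≤ l ≤ m`, where `(x_0, x_1, x_2)` stands for
`(x₁, x₂, z)`. -/
abbrev AffJet (m : ℕ) : Type := Fin 3 → Fin (m + 1) → ℂ

/-- The polynomial `x^{(0)} + x^{(1)} t + ⋯ + x^{(m)} t^m`. -/
def jetPoly {m : ℕ} (a : Fin (m + 1) → ℂ) : Polynomial ℂ :=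
  ∑ l : Fin (m + 1), Polynomial.monomial (l : ℕ) (a l)

/-- The order in `t` of an element of `ℂ[t]/(t^{m+1})` (it is `∞` for the zero element). -/
def jetOrder {m : ℕ} (a : Fin (m + 1) → ℂ) : ℕ∞ := (jetPoly a : PowerSeries ℂ).order

/-- The truncation `π^a_{q,p} : 𝔸³_q → 𝔸³_p`. -/
def truncJet {p q : ℕ} (h : p ≤ q) (γ : AffJet q) : AffJet p :=
  fun i l => γ i (Fin.castLE (Nat.succ_le_succ h) l)

/-- The jets in `𝔸³_m` whose contact orders with `x₁` and `x₂` are `ν_1` and `ν_2`, centred at a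
point with `|x₁|, |x₂| < r`. -/
def contactJets (r : ℝ) (m : ℕ) (ν : Fin 2 → ℕ) : Set (AffJet m) :=
  {γ | ‖γ 0 0‖ < r ∧ ‖γ 1 0‖ < r ∧ jetOrder (γ 0) = ν 0 ∧ jetOrder (γ 1) = ν 1}

/-- The `m`-jets of the surface `{p = 0}`, i.e. the solutions of `p(γ(t)) ≡ 0 mod t^{m+1}`,
centred at a point with `|x₁|, |x₂| < r`. -/
def surfaceJets (p : Polynomial ConvPS) (r : ℝ) (m : ℕ) : Set (AffJet m) :=
  {γ | ‖γ 0 0‖ < r ∧ ‖γ 1 0‖ < r ∧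
    ((m + 1 : ℕ) : ℕ∞) ≤
      analyticOrderAt (fun t : ℂ => evalPoly p fun i => (jetPoly (γ i)).eval t) 0}

/-- The set `D_m^ν` of the surface `{p = 0}`: its `m`-jets with contact orders `ν_1` and `ν_2`
with `x₁` and `x₂`. -/
def setD (p : Polynomial ConvPS) (r : ℝ) (m : ℕ) (ν : Fin 2 → ℕ) : Set (AffJet m) :=
  {γ | γ ∈ surfaceJets p r m ∧ jetOrder (γ 0) = ν 0 ∧ jetOrder (γ 1) = ν 1}

end QOJets

end

namespace QOJets

open Finset

/-! ### Arithmetic of the numerical data -/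

/-! Fix a jet with contact orders ν. After the substitution t = s^n its x-coordinates have analytic
n-th roots, so conjugates of ζ can be evaluated along it. Let χ run over the characters of (ℤ/n)²
and let N_j be the number of those trivial on M_j. The stabilizer of ζ_j is this annihilator
(`IsCharExponents.conj_truncBranch_eq_iff`), whence f_j^{N_j} = ∏_χ (z - ζ_j^χ)
(`IsDefiningPoly.prod_conj`), and N_j n times the order of f_j along the jet is the sum over χ of
the orders in s of z - ζ_j^χ (`FactorsOn.sum_analyticOrderAt`). Counting indices gives N_j = e_j N_g
(`IsCharExponents.stabCard_eq`).

Let j < g, m < l_{j+1}(ν) and d_k = n⟨ν, λ_k⟩. All exponents of ζ - ζ_j are ≥ λ_{j+1}, so z - ζ^χ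
and z - ζ_j^χ agree along the jet to order d_{j+1}. Two cases arise
(`IsCharExponents.order_iff_of_contact`). If no factor reaches order d_{j+1}, corresponding factors
have equal orders, so ord f = e_j ord f_j, and m < e_j ord f_j means [m/e_j] < ord f_j. If the
factor of some χ₀ reaches it, every χ agreeing with χ₀ on M_k reaches d_{k+1}; hence the total
contact, for ζ and for ζ_j alike, is at least Σ_{k≤j} (d_{k+1} - d_k) N_k = N_g n l_{j+1}(ν) > N_g n
m, and both congruences hold. For j = g there is nothing to compare.

A level j exists because m < l_{i(ν)}(ν) (`IsCharExponents.lt_ell_iIndex`), and it is unique because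
l is monotone. -/

theorem pairing_add (ν : Fin 2 → ℕ) (a b : Fin 2 → ℚ) :
    pairing ν (a + b) = pairing ν a + pairing ν b := by
  simp only [pairing, Fin.sum_univ_two, Pi.add_apply]; ring

theorem pairing_sub (ν : Fin 2 → ℕ) (a b : Fin 2 → ℚ) :
    pairing ν (a - b) = pairing ν a - pairing ν b := by
  simp only [pairing, Fin.sum_univ_two, Pi.sub_apply]; ring

theorem pairing_nsmul (ν : Fin 2 → ℕ) (k : ℕ) (a : Fin 2 → ℚ) :
    pairing ν (k • a) = k * pairing ν a := by
  simp only [pairing, Fin.sum_univ_two, Pi.smul_apply, nsmul_eq_mul]; ring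

theorem pairing_mono (ν : Fin 2 → ℕ) {a b : Fin 2 → ℚ} (h : a ≤ b) :
    pairing ν a ≤ pairing ν b :=
  sum_le_sum fun k _ => mul_le_mul_of_nonneg_left (h k) (Nat.cast_nonneg _)

theorem IsCharExponents.lam_le_succ {n : ℕ} {ζ : ConvPS} {g : ℕ} {lam : ℕ → Fin 2 → ℚ}
    (h : IsCharExponents n ζ g lam) {j : ℕ} (hj : j < g) : lam j ≤ lam (j + 1) := by
  rcases Nat.eq_zero_or_pos j with rfl | hj0
  · rw [h.zero]; exact h.nonneg 1 le_rfl hj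
  · exact h.le_succ j hj0 hj

theorem IsCharExponents.lam_mono {n : ℕ} {ζ : ConvPS} {g : ℕ} {lam : ℕ → Fin 2 → ℚ}
    (h : IsCharExponents n ζ g lam) {i j : ℕ} (hij : i ≤ j) (hj : j ≤ g) : lam i ≤ lam j := by
  induction j, hij using Nat.le_induction with
  | base => exact le_rfl
  | succ k hik ih => exact (ih (by omega)).trans (h.lam_le_succ (by omega))

theorem ee_self (g : ℕ) (lam : ℕ → Fin 2 → ℚ) : ee g lam g = 1 := by simp [ee]

theorem ee_eq_mul {g : ℕ} (lam : ℕ → Fin 2 → ℚ) {j : ℕ} (hj : j < g) :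
    ee g lam j = idx lam (j + 1) * ee g lam (j + 1) := by
  have : Ioc j g = insert (j + 1) (Ioc (j + 1) g) := by
    ext i; simp only [mem_Ioc, mem_insert]; omega
  rw [ee, this, prod_insert (by simp), ee]

/-- The rational number `n_j e_j ⟨ν, γ_j⟩`. -/
noncomputable def ellRat (g : ℕ) (lam : ℕ → Fin 2 → ℚ) (ν : Fin 2 → ℕ) (j : ℕ) : ℚ :=
  (idx lam j : ℚ) * ee g lam j * pairing ν (gam lam j)

theorem ell_of_le {g : ℕ} {lam : ℕ → Fin 2 → ℚ} {ν : Fin 2 → ℕ} {j : ℕ} (h : j ≤ g) :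
    ell g lam ν j = (ellRat g lam ν j : ℚ) := if_pos h

theorem ellRat_zero (g : ℕ) (lam : ℕ → Fin 2 → ℚ) (ν : Fin 2 → ℕ) : ellRat g lam ν 0 = 0 := by
  simp [ellRat, gam, pairing]

/-- Multiply the recursion for γ_{j+1} by n_{j+1} e_{j+1} = e_j. In this form growth of l is
governed by the increments of λ alone. -/
theorem ellRat_succ {g : ℕ} (lam : ℕ → Fin 2 → ℚ) (ν : Fin 2 → ℕ) {j : ℕ} (hj : j < g) :
    ellRat g lam ν (j + 1) =
      ellRat g lam ν j + ee g lam j * (pairing ν (lam (j + 1)) - pairing ν (lam j)) := by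
  simp only [ellRat, gam]
  rw [pairing_add, pairing_nsmul, pairing_sub, ee_eq_mul lam hj]
  push_cast
  ring

/-- The shape to be matched with a count of characters: e_k is proportional to the number of
characters trivial on M_k. -/
theorem ellRat_eq_sum {g : ℕ} (lam : ℕ → Fin 2 → ℚ) (ν : Fin 2 → ℕ) {j : ℕ} (hj : j ≤ g) :
    ellRat g lam ν j = ∑ k ∈ range j,
      (ee g lam k : ℚ) * (pairing ν (lam (k + 1)) - pairing ν (lam k)) := by
  induction j with
  | zero => simp [ellRat_zero]
  | succ j ih => rw [ellRat_succ lam ν hj, sum_range_succ, ih (by omega)]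

/-! ### Existence and uniqueness of the level j(m, ν) -/

section Level

variable {n : ℕ} {ζ : ConvPS} {g : ℕ} {lam : ℕ → Fin 2 → ℚ}

theorem IsCharExponents.ell_le_succ (h : IsCharExponents n ζ g lam) (ν : Fin 2 → ℕ) (j : ℕ) :
    ell g lam ν j ≤ ell g lam ν (j + 1) := by
  by_cases hj : j < g
  · rw [ell_of_le hj.le, ell_of_le hj, WithTop.coe_le_coe, ellRat_succ lam ν hj]
    have := mul_nonneg (Nat.cast_nonneg (α := ℚ) (ee g lam j))
      (sub_nonneg.2 (pairing_mono ν (h.lam_le_succ hj)))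
    linarith
  · rw [ell, ell, if_neg (show ¬ j + 1 ≤ g by omega)]; exact le_top

theorem IsCharExponents.ell_monotone (h : IsCharExponents n ζ g lam) (ν : Fin 2 → ℕ) :
    Monotone (ell g lam ν) :=
  monotone_nat_of_le_succ (h.ell_le_succ ν)

theorem one_le_iIndex (g : ℕ) (lam : ℕ → Fin 2 → ℚ) (hg : 1 ≤ g) (ν : Fin 2 → ℕ) :
    1 ≤ iIndex g lam ν := by
  unfold iIndex
  split_ifs with h
  · omega
  · exact (Nat.sInf_mem (s := {i | 1 ≤ i ∧ i ≤ g ∧ ¬ InDual lam i ν}) ⟨g, hg, le_rfl, h⟩).1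

/-- Below m(ν) the strict inequality fails, which says ⟨ν, λ_{k+1} - λ_k⟩ ≤ 0. As the λ_k increase,
this pairing vanishes and l does not grow. -/
theorem IsCharExponents.ell_mIndex (h : IsCharExponents n ζ g lam) (hg : 1 ≤ g)
    (ν : Fin 2 → ℕ) : ell g lam ν (mIndex g lam ν) = ell g lam ν 1 := by
  have hmem := Nat.sInf_mem (s := {i | 1 ≤ i ∧ i ≤ g ∧
    (i < g → (idx lam i : ℚ) * pairing ν (gam lam i) < pairing ν (gam lam (i + 1)))})
    -- The index g always qualifies, because γ_{g+1} = ∞.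
    ⟨g, hg, le_rfl, fun h => absurd h (lt_irrefl _)⟩
  have key : ∀ k, 1 ≤ k → k ≤ mIndex g lam ν → ell g lam ν k = ell g lam ν 1 := by
    intro k hk
    induction k, hk using Nat.le_induction with
    | base => intro _; rfl
    | succ k hk ih =>
      intro hkm
      rw [← ih (by omega)]
      have hkg : k < g := lt_of_lt_of_le hkm hmem.2.1
      have hnot := Nat.notMem_of_lt_sInf (m := k) hkm
      simp only [Set.mem_ofPred_eq, not_and, not_forall] at hnot
      obtain ⟨_, h2⟩ := hnot hk hkg.le
      rw [gam, pairing_add, pairing_nsmul, pairing_sub] at h2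
      have h3 := pairing_mono ν (h.lam_le_succ hkg)
      rw [ell_of_le hkg.le, ell_of_le hkg, ellRat_succ lam ν hkg]
      rw [show pairing ν (lam (k + 1)) - pairing ν (lam k) = 0 by linarith]
      simp
  exact key _ hmem.1 le_rfl

/-- Take the predecessor of the least k with m < l_k(ν); this k is positive since l_0 = 0. -/
theorem exists_isLevel {m : ℕ} {ν : Fin 2 → ℕ}
    (hm : ((m : ℚ) : WithTop ℚ) < ell g lam ν (iIndex g lam ν)) :
    ∃ j, IsLevel g lam m ν j := by
  classical
  have hex : ∃ k, ((m : ℚ) : WithTop ℚ) < ell g lam ν k := ⟨_, hm⟩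
  have h0 : ell g lam ν 0 ≤ ((m : ℚ) : WithTop ℚ) := by
    rw [ell_of_le (Nat.zero_le _), ellRat_zero, WithTop.coe_le_coe]; positivity
  have hpos : Nat.find hex ≠ 0 := fun h' => absurd (h' ▸ Nat.find_spec hex) (not_lt.2 h0)
  have hle : Nat.find hex ≤ iIndex g lam ν := Nat.find_min' hex hm
  refine ⟨Nat.find hex - 1, by omega, not_lt.1 (Nat.find_min hex (by omega)), ?_⟩
  rw [Nat.sub_add_cancel (by omega)]
  exact Nat.find_spec hex

theorem IsCharExponents.isLevel_unique (h : IsCharExponents n ζ g lam) {m : ℕ} {ν : Fin 2 → ℕ}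
    {j j' : ℕ} (hj : IsLevel g lam m ν j) (hj' : IsLevel g lam m ν j') : j' = j := by
  by_contra hne
  rcases lt_or_gt_of_ne hne with hlt | hlt
  · exact absurd (hj'.2.2.trans_le ((h.ell_monotone ν hlt).trans hj.2.1)) (lt_irrefl _)
  · exact absurd (hj.2.2.trans_le ((h.ell_monotone ν hlt).trans hj'.2.1)) (lt_irrefl _)

theorem IsLevel.le {m : ℕ} {ν : Fin 2 → ℕ} {j : ℕ} (hj : IsLevel g lam m ν j) : j ≤ g := by
  by_contra hgj
  have := hj.2.1
  rw [ell, if_neg hgj, top_le_iff] at this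
  exact WithTop.coe_ne_top this

/-- On H_m already l_1(ν) ≥ m + 1, and i(ν) ≥ 1; on L_m the bound is part of the definition. -/
theorem IsCharExponents.lt_ell_iIndex (h : IsCharExponents n ζ g lam) (hg : 1 ≤ g)
    {f : Polynomial ConvPS} {m : ℕ} {ν : Fin 2 → ℕ} (hν : ν ∈ setH f g lam m ∪ setL f g lam m) :
    ((m : ℚ) : WithTop ℚ) < ell g lam ν (iIndex g lam ν) := by
  rcases hν with hν | hν
  · have h1 := hν.2.2
    rw [h.ell_mIndex hg] at h1
    refine lt_of_lt_of_le ?_ (h1.trans (h.ell_monotone ν (one_le_iIndex g lam hg ν)))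
    rw [WithTop.coe_lt_coe]
    exact_mod_cast Nat.lt_succ_self m
  · exact hν.2.2.2.2

end Level

/-! ### Characters of `(ℤ/n)²` trivial on the lattices `M_j` -/

/-- The number of characters of a finite abelian group that are trivial on a subgroup. -/
theorem card_annihilator_mul {A : Type*} [AddCommGroup A] [Finite A] (H : AddSubgroup A) :
    Nat.card {χ : AddChar A ℂ // ∀ a ∈ H, χ a = 1} * Nat.card H = Nat.card A := by
  classical
  have := Fintype.ofFinite A
  -- Double counting of Σ χ(a): summing over χ first leaves only a = 0, summing over H first leaves
  -- only the characters trivial on H.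
  have h1 : ∑ χ : AddChar A ℂ, ∑ a : H, χ a = Fintype.card A := by
    rw [sum_comm]
    simp_rw [AddChar.sum_apply_eq_ite]
    rw [Finset.sum_ite, sum_const_zero, add_zero, sum_const]
    have : (univ.filter fun x : H => (x : A) = 0) = {0} := by
      ext x; simp
    rw [this]; simp
  have h2 : ∀ χ : AddChar A ℂ,
      ∑ a : H, χ a = if ∀ a ∈ H, χ a = 1 then (Fintype.card H : ℂ) else 0 := by
    intro χ
    have h3 := AddChar.sum_eq_ite (χ.compAddMonoidHom H.subtype)
    simp only [AddChar.compAddMonoidHom_apply, AddSubgroup.coe_subtype] at h3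
    rw [h3]
    congr 1
    simp only [eq_iff_iff]
    constructor
    · intro h a ha
      exact DFunLike.congr_fun h (⟨a, ha⟩ : H)
    · intro h
      ext a
      exact h a a.2
  simp_rw [h2] at h1
  rw [Finset.sum_ite, sum_const_zero, add_zero, sum_const, nsmul_eq_mul] at h1
  rw [Nat.card_eq_fintype_card, Nat.card_eq_fintype_card, Nat.card_eq_fintype_card,
    Fintype.card_subtype]
  exact_mod_cast h1

/-- The homomorphism `ℤ² → ℚ²`, `a ↦ a / n`. -/
def divHom (n : ℕ) : (Fin 2 → ℤ) →+ (Fin 2 → ℚ) where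
  toFun a k := (a k : ℚ) / n
  map_zero' := by ext; simp
  map_add' a b := by ext; simp [add_div]

/-- The reduction `ℤ² → (ℤ/n)²`. -/
def redHom (n : ℕ) : (Fin 2 → ℤ) →+ (Fin 2 → ZMod n) :=
  (Int.castAddHom (ZMod n)).compLeft (Fin 2)

/-- The image in `(ℤ/n)²` of `n M_j`. -/
def latMod (n : ℕ) (lam : ℕ → Fin 2 → ℚ) (j : ℕ) : AddSubgroup (Fin 2 → ZMod n) :=
  ((latM lam j).comap (divHom n)).map (redHom n)

theorem latM_mono (lam : ℕ → Fin 2 → ℚ) : Monotone (latM lam) :=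
  monotone_nat_of_le_succ fun _ => le_sup_left

theorem lam_mem_latM {lam : ℕ → Fin 2 → ℚ} {j : ℕ} (hj : 1 ≤ j) : lam j ∈ latM lam j := by
  obtain ⟨k, rfl⟩ : ∃ k, j = k + 1 := ⟨j - 1, by omega⟩
  exact AddSubgroup.mem_sup_right (AddSubgroup.mem_zmultiples _)

/-- The kernel is nℤ², which division by n sends into ℤ² = M_0. Hence no information on M_j is lost
in (ℤ/n)². -/
theorem ker_redHom_le (n : ℕ) (hn : n ≠ 0) (lam : ℕ → Fin 2 → ℚ) (j : ℕ) :
    (redHom n).ker ≤ (latM lam j).comap (divHom n) := by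
  intro a ha
  refine latM_mono lam (Nat.zero_le j) ?_
  have hdvd : ∀ k, (n : ℤ) ∣ a k := fun k => by
    rw [← ZMod.intCast_zmod_eq_zero_iff_dvd]
    exact congrFun ha k
  choose b hb using hdvd
  refine ⟨b, ?_⟩
  ext k
  have : (n : ℚ) ≠ 0 := Nat.cast_ne_zero.2 hn
  simp [divHom, hb k, this]

theorem mem_latMod_redHom {n : ℕ} (hn : n ≠ 0) {lam : ℕ → Fin 2 → ℚ} {j : ℕ} {a : Fin 2 → ℤ} :
    redHom n a ∈ latMod n lam j ↔ divHom n a ∈ latM lam j := by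
  change a ∈ (latMod n lam j).comap (redHom n) ↔ a ∈ (latM lam j).comap (divHom n)
  rw [latMod, AddSubgroup.comap_map_eq_self (ker_redHom_le n hn lam j)]

theorem divHom_natCast (n : ℕ) (a : Fin 2 →₀ ℕ) : divHom n (fun k => (a k : ℤ)) = expo n a := by
  ext k; simp [divHom, expo]

theorem IsCharExponents.latM_le_range {n : ℕ} {ζ : ConvPS} {g : ℕ} {lam : ℕ → Fin 2 → ℚ}
    (h : IsCharExponents n ζ g lam) (hn : n ≠ 0) {j : ℕ} (hj : j ≤ g) :
    latM lam j ≤ (divHom n).range := by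
  induction j with
  | zero =>
    rintro _ ⟨b, rfl⟩
    refine ⟨fun k => n * b k, ?_⟩
    ext k
    have : (n : ℚ) ≠ 0 := Nat.cast_ne_zero.2 hn
    simp [divHom, this]
  | succ j ih =>
    refine sup_le (ih (by omega)) ?_
    rw [AddSubgroup.zmultiples_le]
    obtain ⟨a, ha, -⟩ := h.coeff_ne_zero (j + 1) (by omega) hj
    exact ⟨fun k => (a k : ℤ), (divHom_natCast n a).trans ha⟩

/-- The index [M_{j+1} : M_j] is unchanged when both lattices are pulled back to ℤ² and then reduced
modulo n: M_{j+1} lies in (1/n)ℤ², and the pullbacks contain nℤ². -/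
theorem IsCharExponents.card_latMod_succ {n : ℕ} {ζ : ConvPS} {g : ℕ} {lam : ℕ → Fin 2 → ℚ}
    (h : IsCharExponents n ζ g lam) (hn : n ≠ 0) {j : ℕ} (hj : j < g) :
    Nat.card (latMod n lam (j + 1)) = idx lam (j + 1) * Nat.card (latMod n lam j) := by
  have hle : latMod n lam j ≤ latMod n lam (j + 1) :=
    AddSubgroup.map_mono (AddSubgroup.comap_mono (latM_mono lam (Nat.le_succ j)))
  have h1 : idx lam (j + 1) = (latMod n lam j).relIndex (latMod n lam (j + 1)) := by
    rw [idx, if_neg (Nat.succ_ne_zero j), Nat.add_sub_cancel]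
    conv_lhs => rw [← AddSubgroup.map_comap_eq_self (h.latM_le_range hn hj),
      ← AddSubgroup.relIndex_comap]
    conv_rhs => rw [latMod.eq_def n lam (j + 1), ← AddSubgroup.relIndex_comap, latMod,
      AddSubgroup.comap_map_eq_self (ker_redHom_le n hn lam j)]
  rw [h1, mul_comm, ← AddSubgroup.relIndex_bot_left (latMod n lam j),
    AddSubgroup.relIndex_mul_relIndex _ _ _ bot_le hle, AddSubgroup.relIndex_bot_left]

/-- The number of characters of `(ℤ/n)²` that are trivial on the image of `n M_j`. -/
noncomputable def stabCard (n : ℕ) (lam : ℕ → Fin 2 → ℚ) (j : ℕ) : ℕ :=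
  Nat.card {χ : AddChar (Fin 2 → ZMod n) ℂ // ∀ a ∈ latMod n lam j, χ a = 1}

theorem stabCard_pos (n : ℕ) [NeZero n] (lam : ℕ → Fin 2 → ℚ) (j : ℕ) :
    0 < stabCard n lam j := by
  refine Nat.pos_of_ne_zero fun h => ?_
  have := card_annihilator_mul (latMod n lam j)
  rw [← stabCard, h, zero_mul] at this
  exact Nat.card_pos.ne this

/-- An annihilator has order n² divided by that of the subgroup, so it shrinks by the factor n_{j+1}
from j to j + 1; descend from g. -/
theorem IsCharExponents.stabCard_eq {n : ℕ} [NeZero n] {ζ : ConvPS} {g : ℕ}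
    {lam : ℕ → Fin 2 → ℚ} (h : IsCharExponents n ζ g lam) {j : ℕ} (hj : j ≤ g) :
    stabCard n lam j = ee g lam j * stabCard n lam g := by
  induction hj using Nat.decreasingInduction with
  | self => rw [ee_self, one_mul]
  | of_succ j hj ih =>
    rw [ee_eq_mul lam hj, mul_assoc, ← ih]
    have h1 := card_annihilator_mul (latMod n lam j)
    have h2 := card_annihilator_mul (latMod n lam (j + 1))
    rw [h.card_latMod_succ (NeZero.ne n) hj, ← h1] at h2
    have hpos : 0 < Nat.card (latMod n lam j) := Nat.card_pos
    rw [← stabCard, ← stabCard] at h2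
    refine Nat.eq_of_mul_eq_mul_right hpos ?_
    rw [← h2]; ring

section Support

variable {n : ℕ} {ζ : ConvPS} {g : ℕ} {lam : ℕ → Fin 2 → ℚ}

/-- The support axiom covers only exponents ≥ λ_j. For the others one descends to a smaller index;
λ_0 = 0 ends the descent. -/
theorem IsCharExponents.expo_mem_latM (h : IsCharExponents n ζ g lam) {j : ℕ} (hj : j ≤ g)
    {a : Fin 2 →₀ ℕ} (ha : MvPowerSeries.coeff a ζ.1 ≠ 0)
    (hja : j < g → ¬ lam (j + 1) ≤ expo n a) : expo n a ∈ latM lam j := by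
  induction j with
  | zero =>
    refine h.support a ha 0 hj ?_ hja
    rw [h.zero]
    intro k
    simp only [expo, Pi.zero_apply]
    positivity
  | succ j ih =>
    by_cases hle : lam (j + 1) ≤ expo n a
    · exact h.support a ha (j + 1) hj hle hja
    · exact latM_mono lam (Nat.le_succ j) (ih (by omega) fun _ => hle)

theorem coeff_truncBranch_ne_zero {j : ℕ} {a : Fin 2 →₀ ℕ}
    (ha : MvPowerSeries.coeff a (truncBranch n ζ g lam j).1 ≠ 0) :
    MvPowerSeries.coeff a ζ.1 ≠ 0 ∧ (j < g → ¬ lam (j + 1) ≤ expo n a) := by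
  classical
  rw [truncBranch, coeff_truncSeries] at ha
  split_ifs at ha with hc
  · exact absurd rfl ha
  · exact ⟨ha, fun hj hle => hc ⟨hj, hle⟩⟩

theorem truncBranch_self : truncBranch n ζ g lam g = ζ := by
  classical
  refine Subtype.ext (MvPowerSeries.ext fun a => ?_)
  rw [truncBranch, coeff_truncSeries, if_neg (by simp)]

end Support

end QOJets

namespace QOJets

open Finset Polynomial

/-! ### Conjugation and the ring `ℂ{x₁^{1/n}, x₂^{1/n}}` -/

/-- Absolute convergence on the closed polydisc of radius `r`. -/
def SummableAt (φ : MvPowerSeries (Fin 2) ℂ) (r : ℝ) : Prop :=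
  Summable fun a : Fin 2 →₀ ℕ => ‖MvPowerSeries.coeff a φ‖ * r ^ a.degree

theorem SummableAt.mono {φ : MvPowerSeries (Fin 2) ℂ} {r s : ℝ} (h : SummableAt φ r)
    (hs : 0 < s) (hsr : s ≤ r) : SummableAt φ s :=
  isConvergent_mono hs hsr h

theorem smul_finsupp_injective {n : ℕ} (hn : n ≠ 0) :
    Function.Injective fun a : Fin 2 →₀ ℕ => n • a :=
  nsmul_right_injective hn

theorem coeff_expand_of_notMem_range {n : ℕ} (hn : n ≠ 0) (φ : MvPowerSeries (Fin 2) ℂ)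
    {b : Fin 2 →₀ ℕ} (hb : b ∉ Set.range fun a : Fin 2 →₀ ℕ => n • a) :
    MvPowerSeries.coeff b (MvPowerSeries.expand n hn φ) = 0 := by
  by_contra hne
  refine hb ?_
  have hdvd : ∀ k, n ∣ b k := fun k => by
    by_contra hk
    exact hne (MvPowerSeries.coeff_expand_of_not_dvd n hn φ hk)
  refine ⟨Finsupp.equivFunOnFinite.symm fun k => b k / n, ?_⟩
  ext k
  simp [Nat.mul_div_cancel' (hdvd k)]

theorem summableAt_expand_iff {n : ℕ} (hn : n ≠ 0) {φ : MvPowerSeries (Fin 2) ℂ} {r : ℝ} :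
    SummableAt (MvPowerSeries.expand n hn φ) r ↔ SummableAt φ (r ^ n) := by
  unfold SummableAt
  rw [← (smul_finsupp_injective hn).summable_iff]
  · refine summable_congr fun a => ?_
    simp only [Function.comp, MvPowerSeries.coeff_expand_smul]
    rw [map_nsmul, smul_eq_mul, pow_mul]
  · intro b hb
    rw [coeff_expand_of_notMem_range hn φ hb]; simp

theorem exists_pos_pow_le {n : ℕ} (hn : n ≠ 0) {r : ℝ} (hr : 0 < r) :
    ∃ s : ℝ, 0 < s ∧ s ≤ r ∧ s ^ n ≤ r :=
  ⟨min r 1, lt_min hr one_pos, min_le_left _ _,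
    (pow_le_of_le_one (lt_min hr one_pos).le (min_le_right _ _) hn).trans (min_le_left _ _)⟩

theorem isConvergent_expand {n : ℕ} (hn : n ≠ 0) {φ : MvPowerSeries (Fin 2) ℂ}
    (hφ : IsConvergent φ) : IsConvergent (MvPowerSeries.expand n hn φ) := by
  obtain ⟨r, hr, h⟩ := hφ
  obtain ⟨s, hs, -, hsr⟩ := exists_pos_pow_le hn hr
  exact ⟨s, hs, (summableAt_expand_iff hn).2 (SummableAt.mono h (pow_pos hs n) hsr)⟩

/-- The inclusion of `ℂ{x₁, x₂}` into `ℂ{x₁^{1/n}, x₂^{1/n}}`. -/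
noncomputable def expandConv (n : ℕ) (hn : n ≠ 0) : ConvPS →+* ConvPS :=
  (toFractional n hn).codRestrict ConvPS.toSubring fun φ => isConvergent_expand hn φ.2

theorem coe_expandConv (n : ℕ) (hn : n ≠ 0) (φ : ConvPS) :
    (expandConv n hn φ).1 = MvPowerSeries.expand n hn φ.1 := rfl

theorem expandConv_injective (n : ℕ) (hn : n ≠ 0) : Function.Injective (expandConv n hn) := by
  intro φ ψ h
  refine Subtype.ext (MvPowerSeries.ext fun a => ?_)
  have := congrArg (fun c : ConvPS => MvPowerSeries.coeff (n • a) c.1) h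
  simpa [coe_expandConv] using this

/-- The reduction modulo `n` of an exponent. -/
def redExp (n : ℕ) (a : Fin 2 →₀ ℕ) : Fin 2 → ZMod n := fun k => (a k : ZMod n)

/-- The action of a character of `(ℤ/n)²` on power series: it multiplies the monomial `u^a`
by `χ(a)`. -/
noncomputable def conjFormal {n : ℕ} (χ : AddChar (Fin 2 → ZMod n) ℂ) :
    MvPowerSeries (Fin 2) ℂ →+* MvPowerSeries (Fin 2) ℂ :=
  MvPowerSeries.rescale fun k => χ (Pi.single k 1)

theorem coeff_conjFormal {n : ℕ} (χ : AddChar (Fin 2 → ZMod n) ℂ) (φ : MvPowerSeries (Fin 2) ℂ)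
    (a : Fin 2 →₀ ℕ) :
    MvPowerSeries.coeff a (conjFormal χ φ) = χ (redExp n a) * MvPowerSeries.coeff a φ := by
  rw [conjFormal, MvPowerSeries.coeff_rescale, Finsupp.prod_fintype _ _ (by simp),
    Fin.prod_univ_two, ← AddChar.map_nsmul_eq_pow, ← AddChar.map_nsmul_eq_pow,
    ← AddChar.map_add_eq_mul]
  congr 2
  funext k
  fin_cases k <;> simp [redExp]

/-- Character values have modulus one, so all conjugates share the polydisc of convergence. -/
theorem summableAt_conjFormal_iff {n : ℕ} [NeZero n] (χ : AddChar (Fin 2 → ZMod n) ℂ)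
    {φ : MvPowerSeries (Fin 2) ℂ} {r : ℝ} : SummableAt (conjFormal χ φ) r ↔ SummableAt φ r := by
  unfold SummableAt
  simp_rw [coeff_conjFormal, norm_mul, AddChar.norm_apply, one_mul]

/-- The action of a character of `(ℤ/n)²` on convergent power series. -/
noncomputable def conj {n : ℕ} [NeZero n] (χ : AddChar (Fin 2 → ZMod n) ℂ) : ConvPS →+* ConvPS :=
  ((conjFormal χ).comp (ConvPS.val : ConvPS →+* MvPowerSeries (Fin 2) ℂ)).codRestrict
    ConvPS.toSubring fun φ => by
      obtain ⟨r, hr, h⟩ := φ.2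
      exact ⟨r, hr, (summableAt_conjFormal_iff χ).2 h⟩

instance : IsDomain ConvPS :=
  have : NoZeroDivisors ConvPS := Subtype.val_injective.noZeroDivisors
    (fun φ : ConvPS => φ.1) rfl fun _ _ => rfl
  NoZeroDivisors.to_isDomain _

variable {n : ℕ} [NeZero n]

theorem coeff_conj (χ : AddChar (Fin 2 → ZMod n) ℂ) (φ : ConvPS) (a : Fin 2 →₀ ℕ) :
    MvPowerSeries.coeff a (conj χ φ).1 = χ (redExp n a) * MvPowerSeries.coeff a φ.1 :=
  coeff_conjFormal χ φ.1 a

theorem conj_mul (χ ψ : AddChar (Fin 2 → ZMod n) ℂ) (φ : ConvPS) :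
    conj (χ * ψ) φ = conj χ (conj ψ φ) := by
  refine Subtype.ext (MvPowerSeries.ext fun a => ?_)
  rw [coeff_conj, coeff_conj, coeff_conj, AddChar.mul_apply, mul_assoc]

theorem conj_one (φ : ConvPS) : conj (1 : AddChar (Fin 2 → ZMod n) ℂ) φ = φ := by
  refine Subtype.ext (MvPowerSeries.ext fun a => ?_)
  rw [coeff_conj, AddChar.one_apply, one_mul]

theorem conj_injective (χ : AddChar (Fin 2 → ZMod n) ℂ) : Function.Injective (conj χ) := by
  refine Function.LeftInverse.injective (g := conj χ⁻¹) fun φ => ?_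
  rw [← conj_mul, inv_mul_cancel, conj_one]

theorem conj_expandConv (χ : AddChar (Fin 2 → ZMod n) ℂ) (φ : ConvPS) :
    conj χ (expandConv n (NeZero.ne n) φ) = expandConv n (NeZero.ne n) φ := by
  refine Subtype.ext (MvPowerSeries.ext fun a => ?_)
  rw [coeff_conj, coe_expandConv]
  by_cases ha : a ∈ Set.range fun a : Fin 2 →₀ ℕ => n • a
  · obtain ⟨b, rfl⟩ := ha
    have : redExp n (n • b) = 0 := by ext k; simp [redExp]
    simp [this]
  · rw [coeff_expand_of_notMem_range _ _ ha, mul_zero]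

/-- The convergent series in the `u_i` that are fixed by all characters are those in `x_i`. -/
theorem exists_expandConv_eq {φ : ConvPS} (h : ∀ χ : AddChar (Fin 2 → ZMod n) ℂ, conj χ φ = φ) :
    ∃ ψ, expandConv n (NeZero.ne n) ψ = φ := by
  have hn := NeZero.ne n
  have hcoeff : ∀ b, b ∉ Set.range (fun a : Fin 2 →₀ ℕ => n • a) →
      MvPowerSeries.coeff b φ.1 = 0 := by
    intro b hb
    by_contra hne
    refine hb ?_
    -- A nonzero invariant coefficient at b forces χ(b) = 1 for every χ, and characters separate
    -- points.
    have hred : redExp n b = 0 := by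
      rw [← AddChar.forall_apply_eq_zero]
      intro χ
      have := coeff_conj χ φ b
      rw [h χ] at this
      exact mul_right_cancel₀ hne (this.symm.trans (one_mul _).symm)
    have hdvd : ∀ k, n ∣ b k := fun k => (ZMod.natCast_eq_zero_iff _ _).1 (congrFun hred k)
    refine ⟨Finsupp.equivFunOnFinite.symm fun k => b k / n, ?_⟩
    ext k
    simp [Nat.mul_div_cancel' (hdvd k)]
  let ψ : MvPowerSeries (Fin 2) ℂ := fun a => MvPowerSeries.coeff (n • a) φ.1
  have hψ : MvPowerSeries.expand n hn ψ = φ.1 := by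
    ext b
    by_cases hb : b ∈ Set.range fun a : Fin 2 →₀ ℕ => n • a
    · obtain ⟨a, rfl⟩ := hb
      rw [MvPowerSeries.coeff_expand_smul]; rfl
    · rw [coeff_expand_of_notMem_range hn _ hb, hcoeff b hb]
  obtain ⟨r, hr, hsum⟩ := φ.2
  refine ⟨⟨ψ, r ^ n, pow_pos hr n, ?_⟩, Subtype.ext hψ⟩
  rw [← hψ] at hsum
  exact (summableAt_expand_iff hn).1 hsum

/-! ### The defining polynomial as a product over conjugates -/

theorem map_conj_map_expandConv (χ : AddChar (Fin 2 → ZMod n) ℂ) (p : ConvPS[X]) :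
    (p.map (expandConv n (NeZero.ne n))).map (conj χ) = p.map (expandConv n (NeZero.ne n)) := by
  rw [Polynomial.map_map]
  congr 1
  exact RingHom.ext fun φ => conj_expandConv χ φ

open Classical in
/-- The product of `z - y` over the distinct conjugates `y` of `ξ`. -/
noncomputable def conjPoly (n : ℕ) [NeZero n] (ξ : ConvPS) : ConvPS[X] :=
  ∏ y ∈ univ.image (fun χ : AddChar (Fin 2 → ZMod n) ℂ => conj χ ξ), (X - C y)

theorem conjPoly_monic (ξ : ConvPS) : (conjPoly n ξ).Monic :=
  monic_prod_of_monic _ _ fun y _ => monic_X_sub_C y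

theorem map_conj_conjPoly (ξ : ConvPS) (ψ : AddChar (Fin 2 → ZMod n) ℂ) :
    (conjPoly n ξ).map (conj ψ) = conjPoly n ξ := by
  classical
  unfold conjPoly
  rw [Polynomial.map_prod]
  simp only [Polynomial.map_sub, map_X, map_C]
  rw [← Finset.prod_image (f := fun y => X - C y) (g := conj ψ) ((conj_injective ψ).injOn),
    Finset.image_image]
  refine Finset.prod_congr ?_ fun _ _ => rfl
  ext y
  simp only [Finset.mem_image, mem_univ, true_and, Function.comp, ← conj_mul]
  constructor
  · rintro ⟨χ, rfl⟩; exact ⟨ψ * χ, rfl⟩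
  · rintro ⟨χ, rfl⟩; exact ⟨ψ⁻¹ * χ, by rw [mul_inv_cancel_left]⟩

/-- Galois descent: the orbit product is invariant, so it comes from some q over ℂ{x₁, x₂}. All
conjugates are roots of p, so q divides p, and irreducibility of p leaves only q = p. -/
theorem IsDefiningPoly.map_expandConv_eq {ξ : ConvPS} {p : ConvPS[X]}
    (hp : IsDefiningPoly n (NeZero.ne n) ξ p) :
    p.map (expandConv n (NeZero.ne n)) = conjPoly n ξ := by
  classical
  have hlift : conjPoly n ξ ∈ Polynomial.lifts (expandConv n (NeZero.ne n)) := by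
    rw [Polynomial.lifts_iff_coeff_lifts]
    intro k
    refine exists_expandConv_eq fun χ => ?_
    rw [← Polynomial.coeff_map, map_conj_conjPoly]
  obtain ⟨q, hq, -, hqm⟩ := lifts_and_natDegree_eq_and_monic hlift (conjPoly_monic ξ)
  have hroot : (p.map (expandConv n (NeZero.ne n))).IsRoot ξ := by
    rw [IsRoot, eval_map]
    refine Subtype.ext ?_
    have := hp.root
    rw [IsBranch] at this
    rw [← Subalgebra.coe_val, ← AlgHom.coe_toRingHom, hom_eval₂]
    exact this
  have hdvd : conjPoly n ξ ∣ p.map (expandConv n (NeZero.ne n)) := by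
    unfold conjPoly
    have hp0 : p.map (expandConv n (NeZero.ne n)) ≠ 0 := (hp.monic.map _).ne_zero
    refine (Multiset.prod_X_sub_C_dvd_iff_le_roots hp0 _).2 ?_
    -- The linear factors are distinct, so checking that each conjugate is a root suffices.
    rw [Multiset.le_iff_subset (Finset.nodup _)]
    intro y hy
    obtain ⟨χ, -, rfl⟩ := Finset.mem_image.1 hy
    rw [mem_roots hp0, ← map_conj_map_expandConv χ p]
    exact hroot.map
  rw [← hq, Polynomial.map_dvd_map _ (expandConv_injective n (NeZero.ne n)) hqm] at hdvd
  rw [← hq]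
  congr 1
  rcases hp.irreducible.isUnit_or_isUnit (Classical.choose_spec hdvd) with h | h
  -- A unit q would have degree 0, but its degree is the size of a nonempty orbit.
  · exfalso
    have h1 : (conjPoly n ξ).natDegree = 0 := by
      rw [← hq, hqm.natDegree_map]
      exact natDegree_eq_zero_of_isUnit h
    rw [conjPoly, natDegree_prod_of_monic _ _ fun y _ => monic_X_sub_C y] at h1
    simp only [natDegree_X_sub_C, sum_const, smul_eq_mul, mul_one, Finset.card_eq_zero,
      Finset.image_eq_empty] at h1
    exact univ_nonempty.ne_empty h1
  · refine (eq_of_monic_of_associated hqm hp.monic ?_).symm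
    exact ⟨h.unit, (Classical.choose_spec hdvd).symm⟩

/-- Two polynomials defining the same branch agree. -/
theorem IsDefiningPoly.unique {ξ : ConvPS} {p q : ConvPS[X]}
    (hp : IsDefiningPoly n (NeZero.ne n) ξ p) (hq : IsDefiningPoly n (NeZero.ne n) ξ q) :
    p = q :=
  map_injective _ (expandConv_injective n (NeZero.ne n))
    (hp.map_expandConv_eq.trans hq.map_expandConv_eq.symm)

/-- Orbit and stabilizer: the characters sending ξ to a given conjugate form a coset of the
stabilizer. -/
theorem IsDefiningPoly.prod_conj {ξ : ConvPS} {p : ConvPS[X]}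
    (hp : IsDefiningPoly n (NeZero.ne n) ξ p) :
    ∏ χ : AddChar (Fin 2 → ZMod n) ℂ, (X - C (conj χ ξ)) =
      p.map (expandConv n (NeZero.ne n)) ^
        Nat.card {χ : AddChar (Fin 2 → ZMod n) ℂ // conj χ ξ = ξ} := by
  classical
  rw [hp.map_expandConv_eq, Finset.prod_comp (fun y => X - C y)
    (fun χ : AddChar (Fin 2 → ZMod n) ℂ => conj χ ξ), conjPoly, ← Finset.prod_pow]
  refine Finset.prod_congr rfl fun y hy => ?_
  obtain ⟨ψ, -, rfl⟩ := Finset.mem_image.1 hy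
  congr 1
  rw [Nat.card_eq_fintype_card, Fintype.card_subtype]
  refine Finset.card_bij' (fun χ _ => ψ⁻¹ * χ) (fun χ _ => ψ * χ) ?_ ?_ ?_ ?_
  · intro χ hχ
    simp only [Finset.mem_filter, mem_univ, true_and] at hχ ⊢
    rw [conj_mul, hχ, ← conj_mul, inv_mul_cancel, conj_one]
  · intro χ hχ
    simp only [Finset.mem_filter, mem_univ, true_and] at hχ ⊢
    rw [conj_mul, hχ]
  · intro χ _; exact mul_inv_cancel_left _ _
  · intro χ _; exact inv_mul_cancel_left _ _

/-! ### Supports of the truncations and their stabilizers -/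

theorem mem_latMod_redExp {lam : ℕ → Fin 2 → ℚ} {j : ℕ} {a : Fin 2 →₀ ℕ} :
    redExp n a ∈ latMod n lam j ↔ expo n a ∈ latM lam j := by
  rw [← divHom_natCast, ← mem_latMod_redHom (NeZero.ne n)]
  have : redHom n (fun k => (a k : ℤ)) = redExp n a := by ext k; simp [redHom, redExp]
  rw [this]

variable {ζ : ConvPS} {g : ℕ} {lam : ℕ → Fin 2 → ℚ}

/-- A character that is trivial on `M_k` only moves the terms of `ζ` with exponent
`≥ λ_{k+1}`. -/
theorem IsCharExponents.lam_le_of_moved (h : IsCharExponents n ζ g lam) {k : ℕ} (hk : k < g)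
    {χ ψ : AddChar (Fin 2 → ZMod n) ℂ} (hχ : ∀ a ∈ latMod n lam k, χ a = ψ a)
    {a : Fin 2 →₀ ℕ} (ha : MvPowerSeries.coeff a ζ.1 ≠ 0)
    (hne : χ (redExp n a) ≠ ψ (redExp n a)) : lam (k + 1) ≤ expo n a := by
  by_contra hle
  exact hne (hχ _ (mem_latMod_redExp.2 (h.expo_mem_latM hk.le ha fun _ => hle)))

/-- The exponents of ζ_j lie in M_j; conversely λ_1, …, λ_j all occur in ζ_j and generate M_j over
ℤ². -/
theorem IsCharExponents.conj_truncBranch_eq_iff (h : IsCharExponents n ζ g lam) {j : ℕ}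
    (hj : j ≤ g) (χ : AddChar (Fin 2 → ZMod n) ℂ) :
    conj χ (truncBranch n ζ g lam j) = truncBranch n ζ g lam j ↔
      ∀ a ∈ latMod n lam j, χ a = 1 := by
  classical
  constructor
  · intro hfix
    have hexp : ∀ i, 1 ≤ i → i ≤ j → ∃ a, expo n a = lam i ∧ χ (redExp n a) = 1 := by
      intro i hi hij
      obtain ⟨a, ha, hne⟩ := h.coeff_ne_zero i hi (hij.trans hj)
      refine ⟨a, ha, ?_⟩
      have hcoeff : MvPowerSeries.coeff a (truncBranch n ζ g lam j).1 =
          MvPowerSeries.coeff a ζ.1 := by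
        rw [truncBranch, coeff_truncSeries, if_neg]
        rintro ⟨hjg, hle⟩
        rw [ha] at hle
        -- If the truncation removed the term λ_i, then λ_{j+1} ≤ λ_i ≤ λ_j, so λ_{j+1} = λ_j would
        -- lie in M_j.
        have heq : lam (j + 1) = lam j :=
          le_antisymm (hle.trans (h.lam_mono hij hj)) (h.lam_le_succ hjg)
        refine h.notMem (j + 1) (by omega) hjg ?_
        rw [Nat.add_sub_cancel, heq]
        exact lam_mem_latM (hi.trans hij)
      have h1 := coeff_conj χ (truncBranch n ζ g lam j) a
      rw [hfix, hcoeff] at h1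
      exact mul_right_cancel₀ hne (h1.symm.trans (one_mul _).symm)
    have key : ∀ i ≤ j, ∀ b : Fin 2 → ℤ, divHom n b ∈ latM lam i → χ (redHom n b) = 1 := by
      intro i
      induction i with
      | zero =>
        rintro - b ⟨c, hc⟩
        have hb : redHom n b = 0 := by
          funext k
          have h1 : (c k : ℚ) = b k / n := congrFun hc k
          rw [eq_div_iff (Nat.cast_ne_zero.2 (NeZero.ne n))] at h1
          have h2 : b k = c k * n := by exact_mod_cast h1.symm
          simp [redHom, h2]
        rw [hb, AddChar.map_zero_eq_one]
      | succ i ih =>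
        intro hi b hb
        obtain ⟨y, hy, z, hz, hyz⟩ := AddSubgroup.mem_sup.1 hb
        obtain ⟨k, rfl⟩ := AddSubgroup.mem_zmultiples_iff.1 hz
        obtain ⟨a, ha, hχa⟩ := hexp (i + 1) (by omega) hi
        let a' : Fin 2 → ℤ := fun k => (a k : ℤ)
        have ha' : redHom n a' = redExp n a := by ext k; simp [a', redHom, redExp]
        have h1 : divHom n (b - k • a') = y := by
          rw [map_sub, map_zsmul, divHom_natCast, ha, ← hyz]; abel
        have h2 := ih (by omega) (b - k • a') (h1 ▸ hy)
        rw [map_sub, map_zsmul, ha', AddChar.map_sub_eq_div, AddChar.map_zsmul_eq_zpow, hχa,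
          one_zpow, div_one] at h2
        exact h2
    rintro _ ⟨b, hb, rfl⟩
    exact key j le_rfl b hb
  · intro htriv
    refine Subtype.ext (MvPowerSeries.ext fun a => ?_)
    rw [coeff_conj]
    by_cases ha : MvPowerSeries.coeff a (truncBranch n ζ g lam j).1 = 0
    · rw [ha, mul_zero]
    · obtain ⟨h1, h2⟩ := coeff_truncBranch_ne_zero ha
      rw [htriv _ (mem_latMod_redExp.2 (h.expo_mem_latM hj h1 h2)), one_mul]

theorem IsCharExponents.prod_conj_truncBranch (h : IsCharExponents n ζ g lam) {j : ℕ}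
    (hj : j ≤ g) {p : ConvPS[X]}
    (hp : IsDefiningPoly n (NeZero.ne n) (truncBranch n ζ g lam j) p) :
    ∏ χ : AddChar (Fin 2 → ZMod n) ℂ, (X - C (conj χ (truncBranch n ζ g lam j))) =
      p.map (expandConv n (NeZero.ne n)) ^ stabCard n lam j := by
  rw [hp.prod_conj, stabCard]
  simp_rw [h.conj_truncBranch_eq_iff hj]

end QOJets

namespace QOJets

open Finset Polynomial Filter Topology

/-! ### Evaluation of convergent power series -/

theorem norm_evalTerm_le {φ : MvPowerSeries (Fin 2) ℂ} {ρ : ℝ} {x : Fin 2 → ℂ} (hx : ‖x‖ ≤ ρ)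
    (a : Fin 2 →₀ ℕ) : ‖MvPowerSeries.coeff a φ * (x 0 ^ a 0 * x 1 ^ a 1)‖ ≤
      ‖MvPowerSeries.coeff a φ‖ * ρ ^ a.degree := by
  have h0 : ‖x 0‖ ≤ ρ := (norm_le_pi_norm x 0).trans hx
  have h1 : ‖x 1‖ ≤ ρ := (norm_le_pi_norm x 1).trans hx
  have hρ : 0 ≤ ρ := (norm_nonneg _).trans hx
  rw [norm_mul, norm_mul, norm_pow, norm_pow, Finsupp.degree_eq_sum, Fin.sum_univ_two, pow_add]
  gcongr

theorem SummableAt.summable_norm {φ : MvPowerSeries (Fin 2) ℂ} {ρ : ℝ} (h : SummableAt φ ρ)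
    {x : Fin 2 → ℂ} (hx : ‖x‖ ≤ ρ) :
    Summable fun a : Fin 2 →₀ ℕ => ‖MvPowerSeries.coeff a φ * (x 0 ^ a 0 * x 1 ^ a 1)‖ :=
  Summable.of_nonneg_of_le (fun _ => norm_nonneg _) (norm_evalTerm_le hx) h

theorem SummableAt.norm_evalPS_le {φ : ConvPS} {ρ : ℝ} (h : SummableAt φ.1 ρ)
    {x : Fin 2 → ℂ} (hx : ‖x‖ ≤ ρ) :
    ‖evalPS φ x‖ ≤ ∑' a : Fin 2 →₀ ℕ, ‖MvPowerSeries.coeff a φ.1‖ * ρ ^ a.degree :=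
  tsum_of_norm_bounded h.hasSum (norm_evalTerm_le hx)

theorem evalPS_add {φ ψ : ConvPS} {ρ : ℝ} (hφ : SummableAt φ.1 ρ) (hψ : SummableAt ψ.1 ρ)
    {x : Fin 2 → ℂ} (hx : ‖x‖ ≤ ρ) : evalPS (φ + ψ) x = evalPS φ x + evalPS ψ x := by
  rw [evalPS, evalPS, evalPS,
    ← (hφ.summable_norm hx).of_norm.tsum_add (hψ.summable_norm hx).of_norm]
  refine tsum_congr fun a => ?_
  rw [← add_mul]
  rfl

theorem evalPS_neg (φ : ConvPS) (x : Fin 2 → ℂ) : evalPS (-φ) x = -evalPS φ x := by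
  rw [evalPS, evalPS, ← tsum_neg]
  refine tsum_congr fun a => ?_
  rw [← neg_mul]
  rfl

theorem evalPS_sub {φ ψ : ConvPS} {ρ : ℝ} (hφ : SummableAt φ.1 ρ) (hψ : SummableAt ψ.1 ρ)
    {x : Fin 2 → ℂ} (hx : ‖x‖ ≤ ρ) : evalPS (φ - ψ) x = evalPS φ x - evalPS ψ x := by
  have hneg : SummableAt (-ψ).1 ρ := by
    have : ∀ a, ‖MvPowerSeries.coeff a (-ψ).1‖ = ‖MvPowerSeries.coeff a ψ.1‖ := fun a =>
      norm_neg (MvPowerSeries.coeff a ψ.1)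
    unfold SummableAt
    simp_rw [this]
    exact hψ
  rw [sub_eq_add_neg, evalPS_add hφ hneg hx, evalPS_neg, ← sub_eq_add_neg]

theorem evalPS_mul {φ ψ : ConvPS} {ρ : ℝ} (hφ : SummableAt φ.1 ρ) (hψ : SummableAt ψ.1 ρ)
    {x : Fin 2 → ℂ} (hx : ‖x‖ ≤ ρ) : evalPS (φ * ψ) x = evalPS φ x * evalPS ψ x := by
  have hprod := summable_mul_of_summable_norm
    (f := fun a : Fin 2 →₀ ℕ => MvPowerSeries.coeff a φ.1 * (x 0 ^ a 0 * x 1 ^ a 1))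
    (g := fun a : Fin 2 →₀ ℕ => MvPowerSeries.coeff a ψ.1 * (x 0 ^ a 0 * x 1 ^ a 1))
    (hφ.summable_norm hx) (hψ.summable_norm hx)
  have h := (hφ.summable_norm hx).of_norm.tsum_mul_tsum_eq_tsum_sum_antidiagonal
    (hψ.summable_norm hx).of_norm hprod
  refine Eq.trans (tsum_congr fun a => ?_) h.symm
  rw [show (φ * ψ).1 = φ.1 * ψ.1 from rfl, MvPowerSeries.coeff_mul, Finset.sum_mul]
  refine Finset.sum_congr rfl fun p hp => ?_
  rw [← Finset.HasAntidiagonal.mem_antidiagonal.mp hp, Finsupp.add_apply, Finsupp.add_apply,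
    pow_add, pow_add]
  ring

theorem evalPS_algebraMap (c : ℂ) (x : Fin 2 → ℂ) : evalPS (algebraMap ℂ ConvPS c) x = c := by
  classical
  rw [evalPS, tsum_eq_single 0]
  · change MvPowerSeries.coeff 0 (MvPowerSeries.C c) * _ = c
    simp
  · intro a ha
    change MvPowerSeries.coeff a (MvPowerSeries.C c) * _ = 0
    rw [MvPowerSeries.coeff_C, if_neg ha, zero_mul]

theorem evalPS_expandConv {n : ℕ} (hn : n ≠ 0) (φ : ConvPS) (u : Fin 2 → ℂ) :
    evalPS (expandConv n hn φ) u = evalPS φ ![u 0 ^ n, u 1 ^ n] := by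
  rw [evalPS, evalPS, ← (smul_finsupp_injective hn).tsum_eq]
  · refine tsum_congr fun a => ?_
    rw [coe_expandConv, MvPowerSeries.coeff_expand_smul]
    simp [pow_mul]
  · intro b hb
    by_contra hr
    refine hb ?_
    change MvPowerSeries.coeff b _ * _ = 0
    rw [coe_expandConv, coeff_expand_of_notMem_range hn _ hr, zero_mul]

/-! ### Germs of functions of `(u, z)` near `u = 0` -/

/-- The filter of the sets containing all points `(u, z)` with `u` close to `0`. -/
noncomputable def nearZero : Filter ((Fin 2 → ℂ) × ℂ) := comap Prod.fst (𝓝 0)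

theorem eventually_nearZero {P : (Fin 2 → ℂ) × ℂ → Prop} :
    (∀ᶠ w in nearZero, P w) ↔ ∃ ε > 0, ∀ u : Fin 2 → ℂ, ‖u‖ < ε → ∀ z, P (u, z) := by
  rw [nearZero, eventually_comap, Metric.eventually_nhds_iff]
  simp only [dist_zero_right, Prod.forall]
  exact ⟨fun ⟨ε, hε, h⟩ => ⟨ε, hε, fun u hu z => h hu u z rfl⟩,
    fun ⟨ε, hε, h⟩ => ⟨ε, hε, fun u hu v z huv => h v (huv ▸ hu) z⟩⟩

/-- The ring homomorphism sending a convergent power series to the germ of its sum. -/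
noncomputable def evalGerm : ConvPS →+* Germ nearZero ℂ where
  toFun φ := ((fun w => evalPS φ w.1 : (Fin 2 → ℂ) × ℂ → ℂ) : Germ nearZero ℂ)
  map_one' := by
    have h : ∀ x, evalPS 1 x = 1 := fun x => by
      rw [← map_one (algebraMap ℂ ConvPS), evalPS_algebraMap]
    simp only [h]; rfl
  map_zero' := by
    have h : ∀ x, evalPS 0 x = 0 := fun x => by
      rw [← map_zero (algebraMap ℂ ConvPS), evalPS_algebraMap]
    simp only [h]; rfl
  map_add' φ ψ := by
    obtain ⟨r, hr, h⟩ := φ.2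
    obtain ⟨s, hs, h'⟩ := ψ.2
    have hm : 0 < min r s := lt_min hr hs
    rw [← Germ.coe_add]
    refine Germ.coe_eq.2 (eventually_nearZero.2 ⟨min r s, hm, fun u hu z => ?_⟩)
    exact evalPS_add (isConvergent_mono hm (min_le_left _ _) h)
      (isConvergent_mono hm (min_le_right _ _) h') hu.le
  map_mul' φ ψ := by
    obtain ⟨r, hr, h⟩ := φ.2
    obtain ⟨s, hs, h'⟩ := ψ.2
    have hm : 0 < min r s := lt_min hr hs
    rw [← Germ.coe_mul]
    refine Germ.coe_eq.2 (eventually_nearZero.2 ⟨min r s, hm, fun u hu z => ?_⟩)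
    exact evalPS_mul (isConvergent_mono hm (min_le_left _ _) h)
      (isConvergent_mono hm (min_le_right _ _) h') hu.le

/-- A factorization of a power of `p` into linear factors over `ℂ{x₁^{1/n}, x₂^{1/n}}` holds for
the values near the origin. -/
theorem exists_evalPoly_pow_eq_prod {n : ℕ} (hn : n ≠ 0) {ι : Type*} [Fintype ι]
    (ξ : ι → ConvPS) (p : ConvPS[X]) (N : ℕ)
    (h : ∏ i, (X - C (ξ i)) = p.map (expandConv n hn) ^ N) :
    ∃ ε > 0, ∀ u : Fin 2 → ℂ, ‖u‖ < ε → ∀ z,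
      evalPoly p ![u 0 ^ n, u 1 ^ n, z] ^ N = ∏ i, (z - evalPS (ξ i) u) := by
  -- Evaluating at this germ turns the polynomial identity into one of values. The filter constrains
  -- only u, so a single radius serves all z.
  let zg : Germ nearZero ℂ := ((fun w => w.2 : (Fin 2 → ℂ) × ℂ → ℂ) : Germ nearZero ℂ)
  have h1 := congrArg (eval₂ evalGerm zg) h
  rw [eval₂_finsetProd, eval₂_pow, eval₂_map, eval₂_eq_sum] at h1
  simp only [eval₂_sub, eval₂_X, eval₂_C] at h1
  have h2 : (p.sum fun e a => (evalGerm.comp (expandConv n hn)) a * zg ^ e) =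
      ((fun w => evalPoly p ![w.1 0 ^ n, w.1 1 ^ n, w.2] : (Fin 2 → ℂ) × ℂ → ℂ) :
        Germ nearZero ℂ) := by
    have : (fun w => evalPoly p ![w.1 0 ^ n, w.1 1 ^ n, w.2] : (Fin 2 → ℂ) × ℂ → ℂ) =
        ∑ k ∈ p.support, fun w => evalPS (expandConv n hn (p.coeff k)) w.1 * w.2 ^ k := by
      funext w
      rw [Finset.sum_apply, evalPoly, Polynomial.sum]
      refine Finset.sum_congr rfl fun k _ => ?_
      rw [evalPS_expandConv]
      rfl
    rw [this, ← Germ.coe_coeRingHom, map_sum, Polynomial.sum]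
    rfl
  have h3 : ∏ i, (zg - evalGerm (ξ i)) =
      ((fun w => ∏ i, (w.2 - evalPS (ξ i) w.1) : (Fin 2 → ℂ) × ℂ → ℂ) : Germ nearZero ℂ) := by
    have : (fun w => ∏ i, (w.2 - evalPS (ξ i) w.1) : (Fin 2 → ℂ) × ℂ → ℂ) =
        ∏ i, fun w => (w.2 - evalPS (ξ i) w.1) := by
      funext w
      rw [Finset.prod_apply]
    rw [this, ← Germ.coe_coeRingHom, map_prod]
    rfl
  rw [h2, h3, ← Germ.coe_pow, Germ.coe_eq] at h1
  obtain ⟨ε, hε, h4⟩ := eventually_nearZero.1 h1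
  exact ⟨ε, hε, fun u hu z => (h4 u hu z).symm⟩

/-! ### Analyticity along curves -/

theorem SummableAt.differentiableOn {φ : ConvPS} {ρ : ℝ} (h : SummableAt φ.1 ρ) {U : Set ℂ}
    (hU : IsOpen U) {u : ℂ → Fin 2 → ℂ} (hu : ∀ k, DifferentiableOn ℂ (fun s => u s k) U)
    (hρ : ∀ s ∈ U, ‖u s‖ ≤ ρ) : DifferentiableOn ℂ (fun s => evalPS φ (u s)) U :=
  Complex.differentiableOn_tsum_of_summable_norm h
    (fun _ => (((hu 0).pow _).mul ((hu 1).pow _)).const_mul _) hU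
    fun a s hs => norm_evalTerm_le (hρ s hs) a

theorem SummableAt.analyticAt {φ : ConvPS} {ρ : ℝ} (h : SummableAt φ.1 ρ)
    {u : ℂ → Fin 2 → ℂ} (hu : ∀ k, AnalyticAt ℂ (fun s => u s k) 0) (hρ : ‖u 0‖ < ρ) :
    AnalyticAt ℂ (fun s => evalPS φ (u s)) 0 := by
  have hcont : ContinuousAt u 0 := continuousAt_pi.2 fun k => (hu k).continuousAt
  have h1 : ∀ᶠ s in 𝓝 (0 : ℂ), ‖u s‖ < ρ := hcont.norm.eventually_lt continuousAt_const hρ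
  have h2 : ∀ᶠ s in 𝓝 (0 : ℂ), ∀ k, AnalyticAt ℂ (fun s => u s k) s :=
    eventually_all.2 fun k => (hu k).eventually_analyticAt
  obtain ⟨U, hUsub, hU, h0⟩ := eventually_nhds_iff.1 (h1.and h2)
  exact (h.differentiableOn hU
    (fun k s hs => ((hUsub s hs).2 k).differentiableAt.differentiableWithinAt)
    fun s hs => (hUsub s hs).1.le).analyticAt (hU.mem_nhds h0)

/-- Schwarz lemma on the complex line through x and y, which stays in the larger polydisc for
parameters of modulus below (ρ - ρ')/‖y - x‖. If y is at distance at least ρ - ρ', the bound on φ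
itself suffices. -/
theorem SummableAt.exists_lipschitz {φ : ConvPS} {ρ ρ' : ℝ} (h : SummableAt φ.1 ρ)
    (hρ : ρ' < ρ) : ∃ C : ℝ, ∀ x y : Fin 2 → ℂ, ‖x‖ ≤ ρ' → ‖y‖ ≤ ρ →
      ‖evalPS φ y - evalPS φ x‖ ≤ C * ‖y - x‖ := by
  set M := ∑' a : Fin 2 →₀ ℕ, ‖MvPowerSeries.coeff a φ.1‖ * ρ ^ a.degree
  refine ⟨(M + M) / (ρ - ρ'), fun x y hx hy => ?_⟩
  have hd : 0 < ρ - ρ' := sub_pos.2 hρ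
  have hMx := h.norm_evalPS_le (hx.trans hρ.le)
  have hMy := h.norm_evalPS_le hy
  have hM : 0 ≤ M := (norm_nonneg _).trans hMx
  rcases le_or_gt (ρ - ρ') ‖y - x‖ with hfar | hnear
  · calc ‖evalPS φ y - evalPS φ x‖ ≤ M + M := (norm_sub_le _ _).trans (add_le_add hMy hMx)
      _ = (M + M) / (ρ - ρ') * (ρ - ρ') := by field_simp
      _ ≤ _ := by gcongr
  · rcases eq_or_ne y x with rfl | hne
    · simp
    have hyx : 0 < ‖y - x‖ := norm_pos_iff.2 (sub_ne_zero.2 hne)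
    have hball : ∀ w ∈ Metric.ball (0 : ℂ) ((ρ - ρ') / ‖y - x‖), ‖x + w • (y - x)‖ ≤ ρ := by
      intro w hw
      rw [mem_ball_zero_iff, lt_div_iff₀ hyx] at hw
      calc ‖x + w • (y - x)‖ ≤ ‖x‖ + ‖w‖ * ‖y - x‖ := (norm_add_le _ _).trans_eq (by rw [norm_smul])
        _ ≤ ρ := by linarith
    have key := Complex.dist_le_div_mul_dist_of_mapsTo_ball
      (f := fun w : ℂ => evalPS φ (x + w • (y - x))) (c := 0) (z := 1) (R₂ := M + M)
      (R₁ := (ρ - ρ') / ‖y - x‖)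
      (h.differentiableOn Metric.isOpen_ball (fun k => by
        simp only [Pi.add_apply, Pi.smul_apply, smul_eq_mul]; fun_prop) hball)
      (fun w hw => by
        rw [Metric.mem_closedBall, dist_eq_norm]
        exact (norm_sub_le _ _).trans (add_le_add (h.norm_evalPS_le (hball w hw))
          (h.norm_evalPS_le (by simpa using hx.trans hρ.le))))
      (by rw [mem_ball_zero_iff, norm_one, one_lt_div hyx]; exact hnear)
    simp only [one_smul, zero_smul, add_zero, add_sub_cancel, dist_eq_norm, sub_zero,
      norm_one, mul_one] at key
    refine key.trans_eq ?_
    field_simp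

/-! ### Congruence of germs of analytic functions modulo `t^N` -/

/-- If the order were k < N, the quotient by s^k would be O(|s|^{N-k}) and vanish at 0. -/
theorem le_analyticOrderAt_of_norm_le {f : ℂ → ℂ} (hf : AnalyticAt ℂ f 0) {N : ℕ} {C : ℝ}
    (h : ∀ᶠ s in 𝓝 (0 : ℂ), ‖f s‖ ≤ C * ‖s‖ ^ N) : (N : ℕ∞) ≤ analyticOrderAt f 0 := by
  by_contra hlt
  push Not at hlt
  obtain ⟨k, hk⟩ := ENat.ne_top_iff_exists.1 (ne_top_of_lt hlt)
  rw [← hk, Nat.cast_lt] at hlt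
  obtain ⟨g, hg, hg0, hfg⟩ := (hf.analyticOrderAt_eq_natCast (n := k)).1 hk.symm
  refine hg0 ?_
  have h1 : ∀ᶠ s in 𝓝[≠] (0 : ℂ), ‖g s‖ ≤ C * ‖s‖ ^ (N - k) := by
    filter_upwards [h.filter_mono nhdsWithin_le_nhds, hfg.filter_mono nhdsWithin_le_nhds,
      self_mem_nhdsWithin] with s hs hs' hs0
    have hpos : 0 < ‖s‖ ^ k := pow_pos (norm_pos_iff.2 hs0) k
    rw [hs', sub_zero, norm_smul, norm_pow] at hs
    refine le_of_mul_le_mul_left (hs.trans_eq ?_) hpos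
    rw [mul_left_comm, ← pow_add, Nat.add_sub_cancel' hlt.le]
  have h2 : Tendsto (fun s : ℂ => C * ‖s‖ ^ (N - k)) (𝓝[≠] 0) (𝓝 0) := by
    have : ContinuousAt (fun s : ℂ => C * ‖s‖ ^ (N - k)) 0 := by fun_prop
    have h3 := this.tendsto.mono_left (nhdsWithin_le_nhds (s := {0}ᶜ))
    simpa [zero_pow (show N - k ≠ 0 by omega)] using h3
  have h4 : Tendsto (fun s => ‖g s‖) (𝓝[≠] 0) (𝓝 0) :=
    tendsto_of_tendsto_of_tendsto_of_le_of_le' tendsto_const_nhds h2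
      (Eventually.of_forall fun s => norm_nonneg _) h1
  exact norm_eq_zero.1 (tendsto_nhds_unique
    (hg.continuousAt.norm.tendsto.mono_left nhdsWithin_le_nhds) h4)

theorem exists_norm_le_of_le_analyticOrderAt {f : ℂ → ℂ} (hf : AnalyticAt ℂ f 0) {N : ℕ}
    (h : (N : ℕ∞) ≤ analyticOrderAt f 0) :
    ∃ C : ℝ, ∀ᶠ s in 𝓝 (0 : ℂ), ‖f s‖ ≤ C * ‖s‖ ^ N := by
  obtain ⟨g, hg, hfg⟩ := (natCast_le_analyticOrderAt hf).1 h
  refine ⟨‖g 0‖ + 1, ?_⟩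
  filter_upwards [hfg, hg.continuousAt.norm.eventually_le_const (lt_add_one ‖g 0‖)] with s hs hs'
  rw [hs, sub_zero, norm_smul, norm_pow, mul_comm]
  gcongr

/-- Two germs of analytic functions agree modulo `t^N`. -/
structure CongrMod (N : ℕ) (f g : ℂ → ℂ) : Prop where
  left : AnalyticAt ℂ f 0
  right : AnalyticAt ℂ g 0
  le_order : (N : ℕ∞) ≤ analyticOrderAt (f - g) 0

namespace CongrMod

variable {N : ℕ} {f g f' g' : ℂ → ℂ}

theorem add (h : CongrMod N f g) (h' : CongrMod N f' g') : CongrMod N (f + f') (g + g') := by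
  refine ⟨h.left.add h'.left, h.right.add h'.right, ?_⟩
  rw [add_sub_add_comm]
  exact (le_min h.le_order h'.le_order).trans le_analyticOrderAt_add

theorem mul (h : CongrMod N f g) (h' : CongrMod N f' g') : CongrMod N (f * f') (g * g') := by
  refine ⟨h.left.mul h'.left, h.right.mul h'.right, ?_⟩
  have : f * f' - g * g' = (f - g) * f' + g * (f' - g') := by ring
  rw [this]
  refine (le_min ?_ ?_).trans le_analyticOrderAt_add
  · rw [analyticOrderAt_mul (h.left.sub h.right) h'.left]
    exact h.le_order.trans le_self_add
  · rw [analyticOrderAt_mul h.right (h'.left.sub h'.right)]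
    exact h'.le_order.trans le_add_self

theorem const (N : ℕ) (c : ℂ) : CongrMod N (fun _ => c) (fun _ => c) :=
  ⟨analyticAt_const, analyticAt_const, by
    rw [sub_self, (analyticOrderAt_eq_top (f := 0)).2 (Eventually.of_forall fun _ => rfl)]
    exact le_top⟩

theorem pow (h : CongrMod N f g) (k : ℕ) : CongrMod N (f ^ k) (g ^ k) := by
  induction k with
  | zero => rw [pow_zero, pow_zero]; exact const N 1
  | succ k ih => rw [pow_succ, pow_succ]; exact ih.mul h

theorem sum {ι : Type*} (s : Finset ι) {F G : ι → ℂ → ℂ} (h : ∀ i ∈ s, CongrMod N (F i) (G i)) :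
    CongrMod N (∑ i ∈ s, F i) (∑ i ∈ s, G i) := by
  classical
  induction s using Finset.induction_on with
  | empty => exact const N 0
  | insert i s hi ih =>
    rw [sum_insert hi, sum_insert hi]
    exact (h i (mem_insert_self _ _)).add (ih fun j hj => h j (mem_insert_of_mem hj))

theorem symm (h : CongrMod N f g) : CongrMod N g f :=
  ⟨h.right, h.left, by rw [← neg_sub, analyticOrderAt_neg]; exact h.le_order⟩

theorem le_order_of_le (h : CongrMod N f g) (hf : (N : ℕ∞) ≤ analyticOrderAt f 0) :
    (N : ℕ∞) ≤ analyticOrderAt g 0 := by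
  have : g = f + (g - f) := by ring
  rw [this]
  exact (le_min hf h.symm.le_order).trans le_analyticOrderAt_add

theorem le_order_iff (h : CongrMod N f g) :
    (N : ℕ∞) ≤ analyticOrderAt f 0 ↔ (N : ℕ∞) ≤ analyticOrderAt g 0 :=
  ⟨h.le_order_of_le, h.symm.le_order_of_le⟩

/-- Congruence modulo s^N is an O(|s|^N) bound, and the Lipschitz estimate transports such bounds
through φ. -/
theorem evalPS {φ : ConvPS} {ρ : ℝ} (hφ : SummableAt φ.1 ρ) {x y : ℂ → Fin 2 → ℂ}
    (h : ∀ k, CongrMod N (fun s => x s k) (fun s => y s k)) (hx : ‖x 0‖ < ρ) (hy : ‖y 0‖ < ρ) :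
    CongrMod N (fun s => QOJets.evalPS φ (x s)) (fun s => QOJets.evalPS φ (y s)) := by
  have hxa := hφ.analyticAt (fun k => (h k).left) hx
  have hya := hφ.analyticAt (fun k => (h k).right) hy
  refine ⟨hxa, hya, ?_⟩
  obtain ⟨ρ', hρ', hρ⟩ := exists_between hy
  obtain ⟨K, hK⟩ := hφ.exists_lipschitz hρ
  choose c hc using fun k =>
    exists_norm_le_of_le_analyticOrderAt ((h k).left.sub (h k).right) (h k).le_order
  have hxc : ContinuousAt x 0 := continuousAt_pi.2 fun k => (h k).left.continuousAt
  have hyc : ContinuousAt y 0 := continuousAt_pi.2 fun k => (h k).right.continuousAt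
  refine le_analyticOrderAt_of_norm_le (C := |K| * max (c 0) (c 1)) (hxa.sub hya) ?_
  filter_upwards [eventually_all.2 hc, hxc.norm.eventually_le_const hx,
    hyc.norm.eventually_le_const hρ'] with s hs hsx hsy
  have h1 : ‖x s - y s‖ ≤ max (c 0) (c 1) * ‖s‖ ^ N := by
    have h0 : max (c 0) (c 1) * ‖s‖ ^ N = max (c 0 * ‖s‖ ^ N) (c 1 * ‖s‖ ^ N) :=
      max_mul_of_nonneg _ _ (by positivity)
    have hs0 : ‖x s 0 - y s 0‖ ≤ c 0 * ‖s‖ ^ N := hs 0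
    have hs1 : ‖x s 1 - y s 1‖ ≤ c 1 * ‖s‖ ^ N := hs 1
    rw [h0, pi_norm_le_iff_of_nonneg (le_max_of_le_left ((norm_nonneg _).trans hs0))]
    intro k
    fin_cases k
    · exact le_max_of_le_left hs0
    · exact le_max_of_le_right hs1
  calc ‖QOJets.evalPS φ (x s) - QOJets.evalPS φ (y s)‖ ≤ K * ‖x s - y s‖ := hK _ _ hsy hsx
    _ ≤ |K| * ‖x s - y s‖ := by gcongr; exact le_abs_self K
    _ ≤ |K| * (max (c 0) (c 1) * ‖s‖ ^ N) := by gcongr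
    _ = _ := by ring

theorem evalPoly {p : ConvPS[X]} {ρ : ℝ} (hp : ∀ k, SummableAt (p.coeff k).1 ρ)
    {x y : ℂ → Fin 3 → ℂ} (h : ∀ k, CongrMod N (fun s => x s k) (fun s => y s k))
    (hx0 : ‖x 0 0‖ < ρ) (hx1 : ‖x 0 1‖ < ρ) (hy0 : ‖y 0 0‖ < ρ) (hy1 : ‖y 0 1‖ < ρ) :
    CongrMod N (fun s => QOJets.evalPoly p (x s)) (fun s => QOJets.evalPoly p (y s)) := by
  have hρ : 0 < ρ := (norm_nonneg _).trans_lt hx0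
  have hsum : ∀ w : ℂ → Fin 3 → ℂ, (fun s => QOJets.evalPoly p (w s)) = ∑ k ∈ p.support,
      (fun s => QOJets.evalPS (p.coeff k) ![w s 0, w s 1]) * (fun s => w s 2) ^ k := by
    intro w
    funext s
    rw [Finset.sum_apply, QOJets.evalPoly, Polynomial.sum]
    rfl
  rw [hsum x, hsum y]
  refine sum _ fun k _ => mul (evalPS (hp k) ?_ ?_ ?_) ((h 2).pow k)
  · intro i
    fin_cases i
    · exact h 0
    · exact h 1
  · rw [pi_norm_lt_iff hρ]; intro i; fin_cases i <;> assumption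
  · rw [pi_norm_lt_iff hρ]; intro i; fin_cases i <;> assumption

end CongrMod

/-! ### Orders of power series along curves -/

theorem SummableAt.shift {φ : ConvPS} {ρ : ℝ} (hρ : 0 < ρ) (h : SummableAt φ.1 ρ)
    (b : Fin 2 →₀ ℕ) :
    SummableAt (fun a : Fin 2 →₀ ℕ => MvPowerSeries.coeff (a + b) φ.1) ρ := by
  have h1 := (h.comp_injective (add_left_injective b)).mul_right (ρ ^ b.degree)⁻¹
  refine h1.congr fun a => ?_
  simp only [Function.comp, map_add, pow_add]
  rw [← mul_assoc, mul_assoc, mul_inv_cancel₀ (pow_ne_zero _ hρ.ne'), mul_one]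
  rfl

theorem evalPS_eq_mul_shift {φ ψ : ConvPS} {b : Fin 2 →₀ ℕ}
    (hφ : ∀ a, MvPowerSeries.coeff a φ.1 ≠ 0 → b ≤ a)
    (hψ : ∀ a, MvPowerSeries.coeff a ψ.1 = MvPowerSeries.coeff (a + b) φ.1) (u : Fin 2 → ℂ) :
    evalPS φ u = u 0 ^ b 0 * u 1 ^ b 1 * evalPS ψ u := by
  rw [evalPS, evalPS, ← tsum_mul_left, ← (add_left_injective b).tsum_eq]
  · refine tsum_congr fun a => ?_
    rw [hψ, Finsupp.add_apply, Finsupp.add_apply, pow_add, pow_add]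
    ring
  · intro a ha
    have : b ≤ a := hφ a fun h0 => ha (by simp [h0])
    exact ⟨a - b, tsub_add_cancel_of_le this⟩

/-- If `x^b` divides `φ`, then the order of `φ` along a curve is bounded below by that of
`x^b`. -/
theorem SummableAt.le_analyticOrderAt {φ : ConvPS} {ρ : ℝ} (h : SummableAt φ.1 ρ)
    {b : Fin 2 →₀ ℕ} (hφ : ∀ a, MvPowerSeries.coeff a φ.1 ≠ 0 → b ≤ a)
    {u w : ℂ → Fin 2 → ℂ} {ν : Fin 2 → ℕ} (hw : ∀ k, AnalyticAt ℂ (fun s => w s k) 0)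
    (huw : ∀ s k, u s k = s ^ ν k * w s k) (hu : ‖u 0‖ < ρ) :
    ((ν 0 * b 0 + ν 1 * b 1 : ℕ) : ℕ∞) ≤ analyticOrderAt (fun s => evalPS φ (u s)) 0 := by
  have hρ : 0 < ρ := (norm_nonneg _).trans_lt hu
  have hua : ∀ k, AnalyticAt ℂ (fun s => u s k) 0 := fun k => by
    simp only [huw]
    exact (analyticAt_id.pow _).mul (hw k)
  -- Write φ = x^b ψ: the quotient ψ converges on the same polydisc, and x^b contributes the power
  -- of s.
  have hs := h.shift hρ b
  let ψ : ConvPS := ⟨_, ρ, hρ, hs⟩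
  have hψ := SummableAt.analyticAt (φ := ψ) hs hua hu
  rw [natCast_le_analyticOrderAt (h.analyticAt hua hu)]
  refine ⟨fun s => w s 0 ^ b 0 * w s 1 ^ b 1 * evalPS ψ (u s),
    (((hw 0).pow _).mul ((hw 1).pow _)).mul hψ, Eventually.of_forall fun s => ?_⟩
  rw [evalPS_eq_mul_shift (ψ := ψ) hφ (fun a => rfl) (u s), huw s 0, huw s 1, sub_zero,
    smul_eq_mul, pow_add, pow_mul, pow_mul]
  ring

end QOJets

namespace QOJets

open Finset Polynomial Filter Topology

/-! ### Contact orders with the conjugates -/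

section Counting

variable {n : ℕ} [NeZero n] {ζ : ConvPS} {g : ℕ} {lam : ℕ → Fin 2 → ℚ}

/-- These characters form a coset of the annihilator of M_k. -/
theorem sum_indicator_eq_stabCard (n : ℕ) [NeZero n] (lam : ℕ → Fin 2 → ℚ) (k : ℕ)
    (χ₀ : AddChar (Fin 2 → ZMod n) ℂ)
    [DecidablePred fun χ : AddChar (Fin 2 → ZMod n) ℂ => ∀ a ∈ latMod n lam k, χ a = χ₀ a] :
    (univ.filter fun χ : AddChar (Fin 2 → ZMod n) ℂ => ∀ a ∈ latMod n lam k, χ a = χ₀ a).card =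
      stabCard n lam k := by
  classical
  rw [stabCard, Nat.card_eq_fintype_card, Fintype.card_subtype]
  have hne : ∀ a, χ₀ a ≠ 0 := fun a h0 => by
    have := AddChar.norm_apply χ₀ a
    rw [h0, norm_zero] at this
    exact zero_ne_one this
  refine Finset.card_bij' (fun χ _ => χ₀⁻¹ * χ) (fun χ _ => χ₀ * χ) ?_ ?_ ?_ ?_
  · intro χ hχ
    simp only [Finset.mem_filter, mem_univ, true_and] at hχ ⊢
    intro a ha
    rw [AddChar.mul_apply, hχ a ha, ← AddChar.mul_apply, inv_mul_cancel, AddChar.one_apply]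
  · intro χ hχ
    simp only [Finset.mem_filter, mem_univ, true_and] at hχ ⊢
    intro a ha
    rw [AddChar.mul_apply, hχ a ha, mul_one]
  · intro χ _; exact mul_inv_cancel_left _ _
  · intro χ _; exact inv_mul_cancel_left _ _

/-- Lower bound for the total contact order, when one of the contact orders is large. -/
theorem sum_le_of_contact {j : ℕ} {d : ℕ → ℕ} (hd0 : d 0 = 0) (hd : ∀ k ≤ j, d k ≤ d (k + 1))
    (a : AddChar (Fin 2 → ZMod n) ℂ → ℕ∞)
    (ha : ∀ k ≤ j, ∀ χ ψ : AddChar (Fin 2 → ZMod n) ℂ, (∀ x ∈ latMod n lam k, χ x = ψ x) →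
      (d (k + 1) : ℕ∞) ≤ a ψ → (d (k + 1) : ℕ∞) ≤ a χ)
    {χ₀ : AddChar (Fin 2 → ZMod n) ℂ} (hχ₀ : (d (j + 1) : ℕ∞) ≤ a χ₀) :
    ((∑ k ∈ range (j + 1), (d (k + 1) - d k) * stabCard n lam k : ℕ) : ℕ∞) ≤ ∑ χ, a χ := by
  classical
  have hmono : ∀ k ≤ j + 1, ∀ i ≤ k, d i ≤ d k := by
    intro k hk i hik
    induction k, hik using Nat.le_induction with
    | base => exact le_rfl
    | succ k hik ih => exact (ih (by omega)).trans (hd k (by omega))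
  have htel : ∀ k ≤ j + 1, ∑ i ∈ range k, (d (i + 1) - d i) = d k := by
    intro k hk
    induction k with
    | zero => simp [hd0]
    | succ k ih =>
      rw [sum_range_succ, ih (by omega)]
      have := hd k (by omega)
      omega
  -- If χ agrees with χ₀ on M_k, its contact is at least d_{k+1}, the full telescoping sum up to k;
  -- otherwise step k adds nothing.
  have hbound : ∀ χ, ∀ k ≤ j + 1,
      ((∑ i ∈ range k, if ∀ x ∈ latMod n lam i, χ x = χ₀ x then d (i + 1) - d i else 0 : ℕ) : ℕ∞)
        ≤ a χ := by
    intro χ k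
    induction k with
    | zero => intro _; simp
    | succ k ih =>
      intro hk
      by_cases hc : ∀ x ∈ latMod n lam k, χ x = χ₀ x
      · refine le_trans ?_ (ha k (by omega) χ χ₀ hc
          (le_trans (Nat.cast_le.2 (hmono (j + 1) le_rfl _ hk)) hχ₀))
        rw [Nat.cast_le, ← htel (k + 1) hk]
        refine sum_le_sum fun i _ => ?_
        split_ifs
        · exact le_rfl
        · exact Nat.zero_le _
      · rw [sum_range_succ, if_neg hc, add_zero]
        exact ih (by omega)
  calc ((∑ k ∈ range (j + 1), (d (k + 1) - d k) * stabCard n lam k : ℕ) : ℕ∞)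
      = ((∑ χ : AddChar (Fin 2 → ZMod n) ℂ, ∑ i ∈ range (j + 1),
          if ∀ x ∈ latMod n lam i, χ x = χ₀ x then d (i + 1) - d i else 0 : ℕ) : ℕ∞) := by
        rw [sum_comm]
        congr 1
        refine sum_congr rfl fun i _ => ?_
        rw [Finset.sum_ite, sum_const_zero, add_zero, sum_const, smul_eq_mul,
          sum_indicator_eq_stabCard, mul_comm]
    _ ≤ ∑ χ, a χ := by
        rw [Nat.cast_sum]
        exact sum_le_sum fun χ _ => hbound χ (j + 1) le_rfl

theorem enat_lt_of_lt_mul {c m : ℕ} {F : ℕ∞} (h : ((c * m : ℕ) : ℕ∞) < c * F) :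
    ((m + 1 : ℕ) : ℕ∞) ≤ F := by
  induction F using ENat.recTopCoe with
  | top => exact le_top
  | coe F =>
    rw [← Nat.cast_mul, Nat.cast_lt] at h
    rw [Nat.cast_le]
    exact Nat.lt_of_mul_lt_mul_left h

theorem enat_mul_left_cancel {c : ℕ} (hc : c ≠ 0) {x y : ℕ∞} (h : (c : ℕ∞) * x = c * y) :
    x = y :=
  (ENat.mul_right_strictMono (by exact_mod_cast hc) (ENat.natCast_ne_top c)).injective h

/-- The source of [m/e_j]: m < eF holds exactly when ⌊m/e⌋ < F. -/
theorem enat_succ_le_mul_iff {e m : ℕ} (he : 0 < e) {F : ℕ∞} :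
    ((m + 1 : ℕ) : ℕ∞) ≤ e * F ↔ ((m / e + 1 : ℕ) : ℕ∞) ≤ F := by
  induction F using ENat.recTopCoe with
  | top =>
    rw [ENat.mul_top (by exact_mod_cast he.ne')]
    simp
  | coe F =>
    rw [← Nat.cast_mul, Nat.cast_le, Nat.cast_le, Nat.succ_le_iff, Nat.succ_le_iff,
      Nat.div_lt_iff_lt_mul he, mul_comm]

/-- The comparison of the contact orders `F` and `F'` of a jet with `f` and `f_j`, in terms of
the contact orders `a χ` and `b χ` with the factors over `ℂ{x₁^{1/n}, x₂^{1/n}}`. -/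
theorem IsCharExponents.order_iff_of_contact (h : IsCharExponents n ζ g lam) {j : ℕ} (hj : j < g)
    {ν : Fin 2 → ℕ} {m : ℕ} (hm : (m : ℚ) < ellRat g lam ν (j + 1)) {d : ℕ → ℕ}
    (hd : ∀ k ≤ g, (d k : ℚ) = n * pairing ν (lam k))
    (a b : AddChar (Fin 2 → ZMod n) ℂ → ℕ∞)
    (hab : ∀ χ, a χ = b χ ∨ (d (j + 1) : ℕ∞) ≤ a χ ∧ (d (j + 1) : ℕ∞) ≤ b χ)
    (ha : ∀ k ≤ j, ∀ χ ψ : AddChar (Fin 2 → ZMod n) ℂ, (∀ x ∈ latMod n lam k, χ x = ψ x) →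
      (d (k + 1) : ℕ∞) ≤ a ψ → (d (k + 1) : ℕ∞) ≤ a χ)
    (hb : ∀ k ≤ j, ∀ χ ψ : AddChar (Fin 2 → ZMod n) ℂ, (∀ x ∈ latMod n lam k, χ x = ψ x) →
      (d (k + 1) : ℕ∞) ≤ b ψ → (d (k + 1) : ℕ∞) ≤ b χ)
    {F F' : ℕ∞} (hF : ((stabCard n lam g * n : ℕ) : ℕ∞) * F = ∑ χ, a χ)
    (hF' : ((stabCard n lam j * n : ℕ) : ℕ∞) * F' = ∑ χ, b χ) :
    ((m + 1 : ℕ) : ℕ∞) ≤ F ↔ ((m / ee g lam j + 1 : ℕ) : ℕ∞) ≤ F' := by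
  have hn : 0 < n := Nat.pos_of_ne_zero (NeZero.ne n)
  have hNg := stabCard_pos n lam g
  have hNj := stabCard_pos n lam j
  have hstab := h.stabCard_eq hj.le
  have he : 0 < ee g lam j := by
    rcases Nat.eq_zero_or_pos (ee g lam j) with h0 | h0
    · rw [hstab, h0, zero_mul] at hNj; exact absurd hNj (lt_irrefl _)
    · exact h0
  have hcast : ((stabCard n lam j * n : ℕ) : ℕ∞) * F' =
      ((stabCard n lam g * n : ℕ) : ℕ∞) * (ee g lam j * F') := by
    rw [hstab]; push_cast; ring
  rw [hcast] at hF'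
  rw [← enat_succ_le_mul_iff he]
  -- Either some factor is in contact to order d_{j+1}, and both sides hold, or F = e_j F'.
  by_cases hcase : ∃ χ₀, (d (j + 1) : ℕ∞) ≤ a χ₀
  · obtain ⟨χ₀, hχa⟩ := hcase
    have hχb : (d (j + 1) : ℕ∞) ≤ b χ₀ := by
      rcases hab χ₀ with heq | hle
      · exact heq ▸ hχa
      · exact hle.2
    have hd0 : d 0 = 0 := by
      have := hd 0 (Nat.zero_le _)
      rw [h.zero] at this
      simpa [pairing] using this
    have hdm : ∀ k ≤ j, d k ≤ d (k + 1) := by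
      intro k hk
      rw [← Nat.cast_le (α := ℚ), hd k (by omega), hd (k + 1) (by omega)]
      exact mul_le_mul_of_nonneg_left (pairing_mono ν (h.lam_le_succ (by omega)))
        (Nat.cast_nonneg _)
    -- With N_k = e_k N_g and d_k = n⟨ν, λ_k⟩ the right side equals N_g n l_{j+1}(ν).
    have hS : stabCard n lam g * n * m <
        ∑ k ∈ range (j + 1), (d (k + 1) - d k) * stabCard n lam k := by
      rw [← Nat.cast_lt (α := ℚ)]
      have hsum : ((∑ k ∈ range (j + 1), (d (k + 1) - d k) * stabCard n lam k : ℕ) : ℚ) =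
          (stabCard n lam g * n : ℕ) * ellRat g lam ν (j + 1) := by
        rw [ellRat_eq_sum lam ν hj, Nat.cast_sum, mul_sum]
        refine sum_congr rfl fun k hk => ?_
        have hkj : k ≤ j := Nat.lt_succ_iff.1 (mem_range.1 hk)
        rw [Nat.cast_mul, Nat.cast_sub (hdm k hkj), hd k (by omega), hd (k + 1) (by omega),
          h.stabCard_eq (show k ≤ g by omega)]
        push_cast
        ring
      rw [hsum, Nat.cast_mul]
      exact mul_lt_mul_of_pos_left hm (by positivity)
    have hS' := (Nat.cast_lt (α := ℕ∞)).2 hS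
    exact iff_of_true
      (enat_lt_of_lt_mul ((hS'.trans_le (sum_le_of_contact hd0 hdm a ha hχa)).trans_eq hF.symm))
      (enat_lt_of_lt_mul ((hS'.trans_le (sum_le_of_contact hd0 hdm b hb hχb)).trans_eq hF'.symm))
  · have heq : ∀ χ, a χ = b χ := fun χ =>
      (hab χ).resolve_right fun hle => hcase ⟨χ, hle.1⟩
    simp_rw [← heq] at hF'
    rw [enat_mul_left_cancel (mul_pos hNg hn).ne' (hF.trans hF'.symm)]

end Counting

/-! ### Roots of coordinates along a jet -/

/-- Near 0 the quotient y/y(0) is close to 1, where the principal logarithm is analytic; an n-th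
root of y(0) supplies the constant. -/
theorem exists_analyticAt_pow_eq {n : ℕ} (hn : n ≠ 0) {y : ℂ → ℂ} (hy : AnalyticAt ℂ y 0)
    (hy0 : y 0 ≠ 0) : ∃ w : ℂ → ℂ, AnalyticAt ℂ w 0 ∧ ∀ᶠ t in 𝓝 (0 : ℂ), w t ^ n = y t := by
  obtain ⟨c, hc⟩ := IsAlgClosed.exists_pow_nat_eq (y 0) (Nat.pos_of_ne_zero hn)
  have hq : AnalyticAt ℂ (fun t => y t / y 0) 0 := hy.div analyticAt_const hy0
  have hmem : y 0 / y 0 ∈ Complex.slitPlane := by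
    rw [div_self hy0]; exact Complex.one_mem_slitPlane
  refine ⟨fun t => c * Complex.exp (Complex.log (y t / y 0) / n),
    analyticAt_const.mul ((hq.clog hmem).div analyticAt_const (Nat.cast_ne_zero.2 hn)).cexp, ?_⟩
  filter_upwards [hy.continuousAt.eventually_ne hy0] with t ht
  rw [mul_pow, ← Complex.exp_nat_mul, mul_div_cancel₀ _ (Nat.cast_ne_zero.2 hn),
    Complex.exp_log (div_ne_zero ht hy0), hc, mul_div_cancel₀ _ hy0]

theorem coeff_jetPoly {m : ℕ} (a : Fin (m + 1) → ℂ) (i : ℕ) :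
    (jetPoly a).coeff i = if h : i < m + 1 then a ⟨i, h⟩ else 0 := by
  rw [jetPoly, finsetSum_coeff]
  simp only [coeff_monomial]
  split_ifs with h
  · rw [Finset.sum_eq_single ⟨i, h⟩]
    · simp
    · intro b _ hb
      rw [if_neg]
      intro hbi
      exact hb (Fin.ext hbi)
    · simp
  · refine Finset.sum_eq_zero fun b _ => if_neg ?_
    have := b.2
    omega

theorem jetOrder_eq_iff {m : ℕ} (a : Fin (m + 1) → ℂ) (k : ℕ) :
    jetOrder a = k ↔ (jetPoly a).coeff k ≠ 0 ∧ ∀ i < k, (jetPoly a).coeff i = 0 := by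
  rw [jetOrder, PowerSeries.order_eq_nat]
  simp only [Polynomial.coeff_coe]

theorem exists_eq_X_pow_mul {p : ℂ[X]} {k : ℕ} (h : p.coeff k ≠ 0) (h' : ∀ i < k, p.coeff i = 0) :
    ∃ y : ℂ[X], p = X ^ k * y ∧ y.eval 0 ≠ 0 := by
  obtain ⟨y, rfl⟩ := X_pow_dvd_iff.2 h'
  refine ⟨y, rfl, ?_⟩
  rwa [← coeff_zero_eq_eval_zero, ← coeff_X_pow_mul y k 0, zero_add]

/-- After the substitution `t = s^n`, the coordinates of a jet have analytic `n`-th roots. -/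
theorem exists_root_curve {n : ℕ} (hn : n ≠ 0) {x : Fin 2 → ℂ[X]} {ν : Fin 2 → ℕ}
    (h : ∀ k, (x k).coeff (ν k) ≠ 0 ∧ ∀ i < ν k, (x k).coeff i = 0) :
    ∃ u w : ℂ → Fin 2 → ℂ, (∀ k, AnalyticAt ℂ (fun s => w s k) 0) ∧
      (∀ s k, u s k = s ^ ν k * w s k) ∧
      ∀ᶠ s in 𝓝 (0 : ℂ), ∀ k, u s k ^ n = (x k).eval (s ^ n) := by
  choose y hy hy0 using fun k => exists_eq_X_pow_mul (h k).1 (h k).2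
  choose w hw hwy using fun k => exists_analyticAt_pow_eq hn
    (y := fun t => (y k).eval t) (AnalyticAt.aeval_polynomial analyticAt_id (y k)) (hy0 k)
  have hpow : Tendsto (fun s : ℂ => s ^ n) (𝓝 0) (𝓝 0) := by
    have := (continuous_pow n).tendsto (0 : ℂ)
    rwa [zero_pow hn] at this
  -- From x_k = t^{ν_k} y_k and w_k^n = y_k, the substitution t = s^n gives the root s^{ν_k}
  -- w_k(s^n).
  refine ⟨fun s k => s ^ ν k * w k (s ^ n), fun s k => w k (s ^ n), fun k => ?_,
    fun s k => rfl, ?_⟩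
  · refine AnalyticAt.fun_comp (g := w k) (f := fun s : ℂ => s ^ n) ?_ (by fun_prop)
    simpa [zero_pow hn] using hw k
  · filter_upwards [hpow.eventually (eventually_all.2 hwy)] with s hs k
    rw [mul_pow, hs k, hy k, eval_mul, eval_pow, eval_X, ← pow_mul, ← pow_mul, mul_comm n]

theorem analyticOrderAt_finset_prod {ι : Type*} (s : Finset ι) {A : ι → ℂ → ℂ}
    (hA : ∀ i, AnalyticAt ℂ (A i) 0) :
    analyticOrderAt (∏ i ∈ s, A i) 0 = ∑ i ∈ s, analyticOrderAt (A i) 0 := by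
  classical
  induction s using Finset.induction_on with
  | empty =>
    rw [prod_empty, sum_empty]
    exact analyticOrderAt_eq_zero.2 (Or.inr one_ne_zero)
  | insert i s hi ih =>
    rw [prod_insert hi, sum_insert hi,
      analyticOrderAt_mul (hA i) (Finset.analyticAt_prod _ fun j _ => hA j), ih]

theorem analyticOrderAt_comp_pow {n : ℕ} (hn : n ≠ 0) {f : ℂ → ℂ} (hf : AnalyticAt ℂ f 0) :
    analyticOrderAt (fun s => f (s ^ n)) 0 = n * analyticOrderAt f 0 := by
  have h0 : (0 : ℂ) ^ n = 0 := zero_pow hn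
  have hg : AnalyticAt ℂ (fun s : ℂ => s ^ n) 0 := by fun_prop
  have h1 := AnalyticAt.analyticOrderAt_comp (f := f) (g := fun s : ℂ => s ^ n) (z₀ := 0)
    (by simpa [h0] using hf) hg
  simp only [h0, sub_zero] at h1
  have h2 : analyticOrderAt (fun s : ℂ => s ^ n) 0 = n := by
    rw [AnalyticAt.analyticOrderAt_eq_natCast hg]
    exact ⟨fun _ => 1, analyticAt_const, one_ne_zero, Eventually.of_forall fun s => by simp⟩
  rw [h2, mul_comm] at h1
  exact h1

end QOJets

namespace QOJets

open Finset Polynomial Filter Topology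

/-! ### Comparison of the contact orders with `f` and `f_j` -/

/-- The polynomial `p` and the series `ξ` converge on the polydiscs of radii `ρ ^ n` and `ρ`, and
there `p ^ N` is the product of the linear factors attached to the conjugates of `ξ`. -/
structure FactorsOn (n : ℕ) [NeZero n] (ξ : ConvPS) (p : ConvPS[X]) (N : ℕ) (ρ : ℝ) : Prop where
  pos : 0 < ρ
  summable : SummableAt ξ.1 ρ
  summable_coeff : ∀ k, SummableAt (p.coeff k).1 (ρ ^ n)
  eval_pow : ∀ u : Fin 2 → ℂ, ‖u‖ < ρ → ∀ z, evalPoly p ![u 0 ^ n, u 1 ^ n, z] ^ N =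
    ∏ χ : AddChar (Fin 2 → ZMod n) ℂ, (z - evalPS (conj χ ξ) u)

theorem summableAt_zero (ρ : ℝ) : SummableAt (0 : ConvPS).1 ρ := by
  refine summable_zero.congr fun a => ?_
  rw [show MvPowerSeries.coeff a (0 : ConvPS).1 = 0 from rfl, norm_zero, zero_mul]

theorem exists_summableAt_coeff (p : ConvPS[X]) :
    ∃ ρ > 0, ∀ k, SummableAt (p.coeff k).1 ρ := by
  have key : ∀ N : ℕ, ∃ ρ > 0, ∀ k < N, SummableAt (p.coeff k).1 ρ := by
    intro N
    induction N with
    | zero => exact ⟨1, one_pos, fun k hk => absurd hk (Nat.not_lt_zero k)⟩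
    | succ N ih =>
      obtain ⟨ρ, hρ, h⟩ := ih
      obtain ⟨r, hr, h'⟩ := (p.coeff N).2
      have hm : 0 < min ρ r := lt_min hρ hr
      refine ⟨min ρ r, hm, fun k hk => ?_⟩
      rcases Nat.lt_succ_iff_lt_or_eq.1 hk with hk | rfl
      · exact (h k hk).mono hm (min_le_left _ _)
      · exact SummableAt.mono h' hm (min_le_right _ _)
  obtain ⟨ρ, hρ, h⟩ := key (p.natDegree + 1)
  refine ⟨ρ, hρ, fun k => ?_⟩
  by_cases hk : k < p.natDegree + 1
  · exact h k hk
  · rw [coeff_eq_zero_of_natDegree_lt (by omega)]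
    exact summableAt_zero ρ

section Comparison

variable {n : ℕ} [NeZero n]

theorem FactorsOn.mono {ξ : ConvPS} {p : ConvPS[X]} {N : ℕ} {ρ ρ' : ℝ}
    (h : FactorsOn n ξ p N ρ) (hpos : 0 < ρ') (hle : ρ' ≤ ρ) : FactorsOn n ξ p N ρ' where
  pos := hpos
  summable := h.summable.mono hpos hle
  summable_coeff k := (h.summable_coeff k).mono (pow_pos hpos n) (by gcongr)
  eval_pow u hu z := h.eval_pow u (hu.trans_le hle) z

theorem exists_factorsOn {ξ : ConvPS} {p : ConvPS[X]} {N : ℕ}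
    (h : ∏ χ : AddChar (Fin 2 → ZMod n) ℂ, (X - C (conj χ ξ)) =
      p.map (expandConv n (NeZero.ne n)) ^ N) : ∃ ρ, FactorsOn n ξ p N ρ := by
  obtain ⟨ε, hε, heval⟩ := exists_evalPoly_pow_eq_prod (NeZero.ne n) _ p N h
  obtain ⟨r, hr, hξ⟩ := ξ.2
  obtain ⟨t, ht, hp⟩ := exists_summableAt_coeff p
  obtain ⟨s, hs, hst, hsn⟩ := exists_pos_pow_le (NeZero.ne n) ht
  have hpos : 0 < min ε (min r s) := lt_min hε (lt_min hr hs)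
  refine ⟨min ε (min r s), hpos,
    SummableAt.mono hξ hpos ((min_le_right _ _).trans (min_le_left _ _)), fun k => ?_,
    fun u hu z => heval u (hu.trans_le (min_le_left _ _)) z⟩
  refine (hp k).mono (pow_pos hpos n) (le_trans ?_ hsn)
  gcongr
  exact (min_le_right _ _).trans (min_le_right _ _)

/-- The radius has to be fixed before m and ν, hence before the level j; only finitely many j occur.
-/
theorem exists_common_radius {P : ℕ → ℝ → Prop} (hpos : ∀ j ρ, P j ρ → 0 < ρ)
    (hmono : ∀ j ρ ρ', P j ρ → 0 < ρ' → ρ' ≤ ρ → P j ρ') {g : ℕ} (h : ∀ j ≤ g, ∃ ρ, P j ρ) :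
    ∃ ρ > 0, ∀ j ≤ g, P j ρ := by
  induction g with
  | zero =>
    obtain ⟨ρ, hρ⟩ := h 0 le_rfl
    exact ⟨ρ, hpos _ _ hρ, fun j hj => Nat.le_zero.1 hj ▸ hρ⟩
  | succ g ih =>
    obtain ⟨ρ, hρ, h1⟩ := ih fun j hj => h j (by omega)
    obtain ⟨ρ', h2⟩ := h (g + 1) le_rfl
    have hm : 0 < min ρ ρ' := lt_min hρ (hpos _ _ h2)
    refine ⟨min ρ ρ', hm, fun j hj => ?_⟩
    rcases Nat.le_succ_iff.1 hj with hj | rfl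
    · exact hmono _ _ _ (h1 j hj) hm (min_le_left _ _)
    · exact hmono _ _ _ h2 hm (min_le_right _ _)

theorem expo_le_expo_iff {a b : Fin 2 →₀ ℕ} : expo n b ≤ expo n a ↔ b ≤ a := by
  have hn : (0 : ℚ) < n := Nat.cast_pos.2 (Nat.pos_of_ne_zero (NeZero.ne n))
  refine forall_congr' fun k => ?_
  rw [expo, expo, div_le_div_iff_of_pos_right hn, Nat.cast_le]

/-- The function `t ↦ p(γ(t))`. -/
noncomputable def alongJet (p : ConvPS[X]) {m : ℕ} (γ : AffJet m) (t : ℂ) : ℂ :=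
  evalPoly p fun i => (jetPoly (γ i)).eval t

theorem eval_zero_jetPoly {m : ℕ} (a : Fin (m + 1) → ℂ) : (jetPoly a).eval 0 = a 0 := by
  rw [← coeff_zero_eq_eval_zero, coeff_jetPoly, dif_pos (Nat.succ_pos m)]
  rfl

theorem analyticAt_eval (q : ℂ[X]) (s : ℂ) : AnalyticAt ℂ (fun t => q.eval t) s :=
  AnalyticAt.aeval_polynomial analyticAt_id q

/-- Jets that agree modulo `t^N` give values of `p` that agree modulo `t^N`. -/
theorem congrMod_alongJet {p : ConvPS[X]} {ρ : ℝ} (hp : ∀ k, SummableAt (p.coeff k).1 ρ)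
    {m m' N : ℕ} {γ : AffJet m} {γ' : AffJet m'}
    (h : ∀ i, ∀ k < N, (jetPoly (γ i)).coeff k = (jetPoly (γ' i)).coeff k)
    (h0 : ‖γ 0 0‖ < ρ) (h1 : ‖γ 1 0‖ < ρ) (h0' : ‖γ' 0 0‖ < ρ) (h1' : ‖γ' 1 0‖ < ρ) :
    CongrMod N (alongJet p γ) (alongJet p γ') := by
  refine CongrMod.evalPoly (ρ := ρ) hp (x := fun t i => (jetPoly (γ i)).eval t)
    (y := fun t i => (jetPoly (γ' i)).eval t)
    (fun i => ⟨analyticAt_eval _ _, analyticAt_eval _ _, ?_⟩)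
    ?_ ?_ ?_ ?_
  · have hdvd : X ^ N ∣ jetPoly (γ i) - jetPoly (γ' i) := by
      refine X_pow_dvd_iff.2 fun k hk => ?_
      rw [coeff_sub, h i k hk, sub_self]
    obtain ⟨y, hy⟩ := hdvd
    have hfun : ((fun t => (jetPoly (γ i)).eval t) - fun t => (jetPoly (γ' i)).eval t) =
        fun t => t ^ N * y.eval t := by
      funext t
      rw [Pi.sub_apply, ← eval_sub, hy, eval_mul, eval_pow, eval_X]
    have hy' := analyticAt_eval y 0
    rw [hfun, natCast_le_analyticOrderAt (by fun_prop)]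
    exact ⟨_, hy', Eventually.of_forall fun t => by rw [sub_zero, smul_eq_mul]⟩
  all_goals simpa only [eval_zero_jetPoly]

variable {ζ : ConvPS} {g : ℕ} {lam : ℕ → Fin 2 → ℚ}

theorem coeff_conj_sub_conj (χ ψ : AddChar (Fin 2 → ZMod n) ℂ) (φ ψ' : ConvPS)
    (a : Fin 2 →₀ ℕ) : MvPowerSeries.coeff a (conj χ φ - conj ψ ψ').1 =
      χ (redExp n a) * MvPowerSeries.coeff a φ.1 - ψ (redExp n a) * MvPowerSeries.coeff a ψ'.1 := by
  rw [← coeff_conj, ← coeff_conj]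
  rfl

/-- The total contact order with the conjugates of `ξ`. -/
theorem FactorsOn.sum_analyticOrderAt {ξ : ConvPS} {p : ConvPS[X]} {N : ℕ} {ρ : ℝ}
    (h : FactorsOn n ξ p N ρ) {m : ℕ} {γ : AffJet m} (hγ0 : ‖γ 0 0‖ < ρ ^ n)
    (hγ1 : ‖γ 1 0‖ < ρ ^ n) {u : ℂ → Fin 2 → ℂ} (hu : ∀ k, AnalyticAt ℂ (fun s => u s k) 0)
    (hu0 : ‖u 0‖ < ρ)
    (hpow : ∀ᶠ s in 𝓝 (0 : ℂ), u s 0 ^ n = (jetPoly (γ 0)).eval (s ^ n) ∧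
      u s 1 ^ n = (jetPoly (γ 1)).eval (s ^ n)) :
    ((N * n : ℕ) : ℕ∞) * analyticOrderAt (alongJet p γ) 0 =
      ∑ χ : AddChar (Fin 2 → ZMod n) ℂ, analyticOrderAt
        (fun s => (jetPoly (γ 2)).eval (s ^ n) - evalPS (conj χ ξ) (u s)) 0 := by
  have hn := NeZero.ne n
  have hA : ∀ χ : AddChar (Fin 2 → ZMod n) ℂ, AnalyticAt ℂ
      (fun s => (jetPoly (γ 2)).eval (s ^ n) - evalPS (conj χ ξ) (u s)) 0 := fun χ =>
    (AnalyticAt.fun_comp (g := fun t => (jetPoly (γ 2)).eval t) (f := fun s : ℂ => s ^ n)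
      (analyticAt_eval _ _) (by fun_prop)).sub
      (((summableAt_conjFormal_iff χ).2 h.summable).analyticAt (φ := conj χ ξ) hu hu0)
  have hH : AnalyticAt ℂ (alongJet p γ) 0 :=
    (congrMod_alongJet (N := 0) h.summable_coeff (fun _ _ _ => rfl) hγ0 hγ1 hγ0 hγ1).left
  have hHn : AnalyticAt ℂ (fun s => alongJet p γ (s ^ n)) 0 :=
    AnalyticAt.fun_comp (g := alongJet p γ) (f := fun s : ℂ => s ^ n)
      (by simpa [zero_pow hn] using hH) (by fun_prop)
  -- The factor N comes from the power of p, the factor n from t = s^n.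
  rw [← analyticOrderAt_finset_prod _ hA, Nat.cast_mul, mul_assoc,
    ← analyticOrderAt_comp_pow hn hH, ← nsmul_eq_mul, ← analyticOrderAt_pow hHn]
  refine analyticOrderAt_congr ?_
  have hcont : ContinuousAt u 0 := continuousAt_pi.2 fun k => (hu k).continuousAt
  filter_upwards [hpow, hcont.norm.eventually_lt continuousAt_const hu0] with s hs hsρ
  rw [Finset.prod_apply, ← h.eval_pow (u s) hsρ, Pi.pow_apply, alongJet, hs.1, hs.2]
  congr 2
  funext i
  fin_cases i <;> rfl

/-- For a jet with contact orders `ν` and `m < l_{j+1}(ν)`, the jet lies on `{f = 0}` modulo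
`t^{m+1}` iff it lies on `{f_j = 0}` modulo `t^{[m/e_j]+1}`. -/
theorem IsCharExponents.order_alongJet_iff (h : IsCharExponents n ζ g lam) {j : ℕ} (hj : j < g)
    {p q : ConvPS[X]} {ρ : ℝ} (hp : FactorsOn n ζ p (stabCard n lam g) ρ)
    (hq : FactorsOn n (truncBranch n ζ g lam j) q (stabCard n lam j) ρ)
    {ν : Fin 2 → ℕ} {m : ℕ} (hm : (m : ℚ) < ellRat g lam ν (j + 1)) {γ : AffJet m}
    (hγ0 : ‖γ 0 0‖ < ρ ^ n) (hγ1 : ‖γ 1 0‖ < ρ ^ n)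
    (hν0 : jetOrder (γ 0) = ν 0) (hν1 : jetOrder (γ 1) = ν 1) :
    ((m + 1 : ℕ) : ℕ∞) ≤ analyticOrderAt (alongJet p γ) 0 ↔
      ((m / ee g lam j + 1 : ℕ) : ℕ∞) ≤ analyticOrderAt (alongJet q γ) 0 := by
  classical
  have hn := NeZero.ne n
  have hnQ : (n : ℚ) ≠ 0 := Nat.cast_ne_zero.2 hn
  obtain ⟨u, w, hw, huw, hun⟩ := exists_root_curve hn
    (x := ![jetPoly (γ 0), jetPoly (γ 1)]) (ν := ν) (by
      intro k
      fin_cases k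
      · exact (jetOrder_eq_iff _ _).1 hν0
      · exact (jetOrder_eq_iff _ _).1 hν1)
  have hu : ∀ k, AnalyticAt ℂ (fun s => u s k) 0 := fun k => by
    simp only [huw]
    exact (analyticAt_id.pow _).mul (hw k)
  have hu0 : ‖u 0‖ < ρ := by
    rw [pi_norm_lt_iff hp.pos]
    intro k
    refine lt_of_pow_lt_pow_left₀ n hp.pos.le ?_
    rw [← norm_pow, hun.self_of_nhds k, zero_pow hn]
    fin_cases k
    · exact (congrArg norm (eval_zero_jetPoly (γ 0))).trans_lt hγ0
    · exact (congrArg norm (eval_zero_jetPoly (γ 1))).trans_lt hγ1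
  have hpow : ∀ᶠ s in 𝓝 (0 : ℂ), u s 0 ^ n = (jetPoly (γ 0)).eval (s ^ n) ∧
      u s 1 ^ n = (jetPoly (γ 1)).eval (s ^ n) := by
    filter_upwards [hun] with s hs
    exact ⟨hs 0, hs 1⟩
  -- λ_k = b_k/n with integral b_k, so that n⟨ν, λ_k⟩ is a natural number; the value 0 for k > g is
  -- a dummy.
  have hexp : ∀ k, ∃ b : Fin 2 →₀ ℕ, k ≤ g → expo n b = lam k := by
    intro k
    by_cases hk : k ≤ g
    · rcases Nat.eq_zero_or_pos k with rfl | hk0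
      · exact ⟨0, fun _ => by rw [h.zero]; ext i; simp [expo]⟩
      · obtain ⟨b, hb, -⟩ := h.coeff_ne_zero k hk0 hk
        exact ⟨b, fun _ => hb⟩
    · exact ⟨0, fun hk' => absurd hk' hk⟩
  choose b hb using hexp
  have horder : ∀ φ : ConvPS, SummableAt φ.1 ρ → ∀ k ≤ g,
      (∀ a, MvPowerSeries.coeff a φ.1 ≠ 0 → lam k ≤ expo n a) →
      ((ν 0 * b k 0 + ν 1 * b k 1 : ℕ) : ℕ∞) ≤ analyticOrderAt (fun s => evalPS φ (u s)) 0 := by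
    intro φ hφ k hk hsupp
    refine hφ.le_analyticOrderAt (fun a ha => ?_) hw huw hu0
    rw [← expo_le_expo_iff (n := n), hb k hk]
    exact hsupp a ha
  -- In a difference of two factors z cancels; if the remaining series is divisible by x^{λ_k}, its
  -- order along the jet is at least n⟨ν, λ_k⟩.
  have hsub : ∀ (χ ψ : AddChar (Fin 2 → ZMod n) ℂ) (φ φ' : ConvPS), SummableAt φ.1 ρ →
      SummableAt φ'.1 ρ → ∀ k ≤ g,
      (∀ a, χ (redExp n a) * MvPowerSeries.coeff a φ.1 ≠
        ψ (redExp n a) * MvPowerSeries.coeff a φ'.1 → lam k ≤ expo n a) →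
      ((ν 0 * b k 0 + ν 1 * b k 1 : ℕ) : ℕ∞) ≤ analyticOrderAt
        ((fun s => (jetPoly (γ 2)).eval (s ^ n) - evalPS (conj ψ φ') (u s)) -
          (fun s => (jetPoly (γ 2)).eval (s ^ n) - evalPS (conj χ φ) (u s))) 0 := by
    intro χ ψ φ φ' hφ hφ' k hk hsupp
    have h1 : SummableAt (conj χ φ).1 ρ := (summableAt_conjFormal_iff χ).2 hφ
    have h2 : SummableAt (conj ψ φ').1 ρ := (summableAt_conjFormal_iff ψ).2 hφ'
    have h3 : SummableAt (conj χ φ - conj ψ φ').1 ρ := by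
      refine Summable.of_nonneg_of_le (fun a => mul_nonneg (norm_nonneg _)
        (pow_nonneg hp.pos.le _)) (fun a => ?_) (Summable.add h1 h2)
      rw [← add_mul]
      exact mul_le_mul_of_nonneg_right (norm_sub_le _ _) (pow_nonneg hp.pos.le _)
    refine (horder _ h3 k hk fun a ha => hsupp a fun heq => ha ?_).trans_eq
      (analyticOrderAt_congr ?_)
    · rw [coeff_conj_sub_conj, heq, sub_self]
    · have hcont : ContinuousAt u 0 := continuousAt_pi.2 fun k => (hu k).continuousAt
      filter_upwards [hcont.norm.eventually_lt continuousAt_const hu0] with s hs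
      rw [evalPS_sub h1 h2 hs.le, Pi.sub_apply]
      ring
  -- Characters agreeing on M_k differ only on terms with exponent ≥ λ_{k+1}. This serves both ζ and
  -- ζ_j, as the support of ζ_j lies in that of ζ.
  have hmoved : ∀ φ : ConvPS, SummableAt φ.1 ρ →
      (∀ a, MvPowerSeries.coeff a φ.1 ≠ 0 → MvPowerSeries.coeff a ζ.1 ≠ 0) → ∀ k ≤ j,
      ∀ χ ψ : AddChar (Fin 2 → ZMod n) ℂ, (∀ x ∈ latMod n lam k, χ x = ψ x) →
      ((ν 0 * b (k + 1) 0 + ν 1 * b (k + 1) 1 : ℕ) : ℕ∞) ≤ analyticOrderAt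
        (fun s => (jetPoly (γ 2)).eval (s ^ n) - evalPS (conj ψ φ) (u s)) 0 →
      ((ν 0 * b (k + 1) 0 + ν 1 * b (k + 1) 1 : ℕ) : ℕ∞) ≤ analyticOrderAt
        (fun s => (jetPoly (γ 2)).eval (s ^ n) - evalPS (conj χ φ) (u s)) 0 := by
    intro φ hφ hsupp k hk χ ψ hχψ hle
    have h1 := hsub ψ χ φ φ hφ hφ (k + 1) (by omega) fun a ha =>
      h.lam_le_of_moved (by omega) hχψ (hsupp a fun h0 => ha (by rw [h0, mul_zero, mul_zero]))
        fun heq => ha (by rw [heq])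
    have h2 := (le_min hle h1).trans le_analyticOrderAt_add
    rwa [add_sub_cancel] at h2
  refine h.order_iff_of_contact hj hm (d := fun k => ν 0 * b k 0 + ν 1 * b k 1) ?_ _ _ ?_
    (hmoved ζ hp.summable fun a ha => ha)
    (hmoved _ hq.summable fun a ha => (coeff_truncBranch_ne_zero ha).1)
    (hp.sum_analyticOrderAt hγ0 hγ1 hu hu0 hpow) (hq.sum_analyticOrderAt hγ0 hγ1 hu hu0 hpow)
  · intro k hk
    rw [← hb k hk, pairing, Fin.sum_univ_two, expo, expo]
    push_cast
    field_simp
  · intro χ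
    have h1 := hsub χ χ ζ (truncBranch n ζ g lam j) hp.summable hq.summable (j + 1) hj
      fun a ha => by
        by_contra hle
        refine ha ?_
        rw [truncBranch, coeff_truncSeries, if_neg fun hc => hle hc.2]
    set A := fun s => (jetPoly (γ 2)).eval (s ^ n) - evalPS (conj χ ζ) (u s)
    set B := fun s => (jetPoly (γ 2)).eval (s ^ n) -
      evalPS (conj χ (truncBranch n ζ g lam j)) (u s)
    have hBA : B = A + (B - A) := by ring
    -- The perturbation B - A has order at least d_{j+1}: it preserves smaller orders and cannot
    -- push larger ones below this threshold.
    rcases lt_or_ge (analyticOrderAt A 0)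
      ((ν 0 * b (j + 1) 0 + ν 1 * b (j + 1) 1 : ℕ) : ℕ∞) with hlt | hge
    · left
      rw [hBA, analyticOrderAt_add_eq_left_of_lt (hlt.trans_le h1)]
    · right
      refine ⟨hge, ?_⟩
      rw [hBA]
      exact (le_min hge h1).trans le_analyticOrderAt_add

end Comparison

/-! ### Truncation of jets -/

theorem coeff_jetPoly_truncJet {p q : ℕ} (h : p ≤ q) (γ : AffJet q) (i : Fin 3) {k : ℕ}
    (hk : k < p + 1) : (jetPoly (truncJet h γ i)).coeff k = (jetPoly (γ i)).coeff k := by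
  rw [coeff_jetPoly, coeff_jetPoly, dif_pos hk, dif_pos (by omega)]
  rfl

/-- A p-jet sees only orders up to p; hence the condition ν_k ≤ [m/e_j] in the second formula. -/
theorem jetOrder_truncJet_iff {p q : ℕ} (h : p ≤ q) (γ : AffJet q) (i : Fin 3) {k : ℕ}
    (hk : k ≤ p) : jetOrder (truncJet h γ i) = k ↔ jetOrder (γ i) = k := by
  rw [jetOrder_eq_iff, jetOrder_eq_iff, coeff_jetPoly_truncJet h γ i (by omega)]
  refine and_congr_right fun _ => forall₂_congr fun l hl => ?_
  rw [coeff_jetPoly_truncJet h γ i (by omega)]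

theorem truncJet_mem_surfaceJets_iff {p : ConvPS[X]} {r ρ : ℝ} (hr : r ≤ ρ)
    (hp : ∀ k, SummableAt (p.coeff k).1 ρ) {m q : ℕ} (h : q ≤ m) {γ : AffJet m}
    (h0 : ‖γ 0 0‖ < r) (h1 : ‖γ 1 0‖ < r) :
    truncJet h γ ∈ surfaceJets p r q ↔
      ((q + 1 : ℕ) : ℕ∞) ≤ analyticOrderAt (alongJet p γ) 0 := by
  have h0' : ‖truncJet h γ 0 0‖ < r := h0
  have h1' : ‖truncJet h γ 1 0‖ < r := h1
  rw [← (congrMod_alongJet (N := q + 1) hp (fun i k hk => coeff_jetPoly_truncJet h γ i hk)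
    (h0'.trans_le hr) (h1'.trans_le hr) (h0.trans_le hr) (h1.trans_le hr)).le_order_iff]
  exact ⟨fun hm => hm.2.2, fun hm => ⟨h0', h1', hm⟩⟩

end QOJets

/-! ### Proof of the proposition -/

theorem proposition4p7
    (f : Polynomial QOJets.ConvPS) (hf : QOJets.IsQuasiOrdinary f) (hirr : Irreducible f)
    (n : ℕ) (hn : n ≠ 0) (hdeg : f.natDegree = n)
    (ζ : QOJets.ConvPS) (hζ : QOJets.IsBranch n hn f ζ)
    (g : ℕ) (hg : 1 ≤ g) (lam : ℕ → Fin 2 → ℚ) (hlam : QOJets.IsCharExponents n ζ g lam)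
    (hlex : QOJets.LexOrdered g lam) (hnorm : QOJets.Normalized lam)
    (fs : ℕ → Polynomial QOJets.ConvPS)
    (hfs : ∀ j ≤ g, QOJets.IsDefiningPoly n hn (QOJets.truncBranch n ζ g lam j) (fs j)) :
    ∃ r₀ : ℝ, 0 < r₀ ∧ ∀ r : ℝ, 0 < r → r ≤ r₀ →
      ∀ m : ℕ, 0 < m → ∀ ν ∈ QOJets.setH f g lam m ∪ QOJets.setL f g lam m,
        ∃ j : ℕ, QOJets.IsLevel g lam m ν j ∧ (∀ j', QOJets.IsLevel g lam m ν j' → j' = j) ∧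
          QOJets.setD f r m ν =
            QOJets.contactJets r m ν ∩
              QOJets.truncJet (Nat.div_le_self m (QOJets.ee g lam j)) ⁻¹'
                QOJets.surfaceJets (fs j) r (m / QOJets.ee g lam j) ∧
          ((∀ k, ν k ≤ m / QOJets.ee g lam j) →
            QOJets.setD f r m ν =
              QOJets.truncJet (Nat.div_le_self m (QOJets.ee g lam j)) ⁻¹'
                QOJets.setD (fs j) r (m / QOJets.ee g lam j) ν) := by
  have : NeZero n := ⟨hn⟩
  obtain ⟨ρ, hρ, hfac⟩ := QOJets.exists_common_radius
    (P := fun j ρ => QOJets.FactorsOn n (QOJets.truncBranch n ζ g lam j) (fs j)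
      (QOJets.stabCard n lam j) ρ) (fun _ _ h => h.pos) (fun _ _ _ h => h.mono)
    (g := g) fun j hj => QOJets.exists_factorsOn (hlam.prod_conj_truncBranch hj (hfs j hj))
  have hfg : fs g = f := (hfs g le_rfl).unique ⟨hf.monic, hirr, by
    rw [QOJets.truncBranch_self]; exact hζ⟩
  have hfacf := hfac g le_rfl
  rw [hfg, QOJets.truncBranch_self] at hfacf
  -- The radius ρ bounds u, and x = u^n.
  refine ⟨ρ ^ n, pow_pos hρ n, fun r hr hrρ m hm ν hν => ?_⟩
  obtain ⟨j, hj⟩ := QOJets.exists_isLevel (hlam.lt_ell_iIndex hg hν)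
  have hiff : ∀ γ ∈ QOJets.contactJets r m ν,
      (((m + 1 : ℕ) : ℕ∞) ≤ analyticOrderAt (QOJets.alongJet f γ) 0 ↔
        QOJets.truncJet (Nat.div_le_self m (QOJets.ee g lam j)) γ ∈
          QOJets.surfaceJets (fs j) r (m / QOJets.ee g lam j)) := by
    rintro γ ⟨h0, h1, hν0, hν1⟩
    rw [QOJets.truncJet_mem_surfaceJets_iff hrρ (hfac j hj.le).summable_coeff _ h0 h1]
    -- At j = g one has e_g = 1 and f_g = f, so the two conditions coincide.
    rcases hj.le.lt_or_eq with hjg | rfl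
    · refine hlam.order_alongJet_iff hjg hfacf (hfac j hjg.le) ?_ (h0.trans_le hrρ)
        (h1.trans_le hrρ) hν0 hν1
      have := hj.2.2
      rwa [QOJets.ell_of_le hjg, WithTop.coe_lt_coe] at this
    · rw [QOJets.ee_self, Nat.div_one, hfg]
  have hfirst : QOJets.setD f r m ν = QOJets.contactJets r m ν ∩
      QOJets.truncJet (Nat.div_le_self m (QOJets.ee g lam j)) ⁻¹'
        QOJets.surfaceJets (fs j) r (m / QOJets.ee g lam j) := by
    ext γ
    constructor
    · rintro ⟨⟨h0, h1, hord⟩, hν0, hν1⟩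
      exact ⟨⟨h0, h1, hν0, hν1⟩, (hiff γ ⟨h0, h1, hν0, hν1⟩).1 hord⟩
    · rintro ⟨hc, ht⟩
      exact ⟨⟨hc.1, hc.2.1, (hiff γ hc).2 ht⟩, hc.2.2⟩
  refine ⟨j, hj, fun j' hj' => hlam.isLevel_unique hj hj', hfirst, fun hle => ?_⟩
  rw [hfirst]
  ext γ
  have e0 := QOJets.jetOrder_truncJet_iff (Nat.div_le_self m (QOJets.ee g lam j)) γ 0 (hle 0)
  have e1 := QOJets.jetOrder_truncJet_iff (Nat.div_le_self m (QOJets.ee g lam j)) γ 1 (hle 1)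
  constructor
  · rintro ⟨⟨-, -, hν0, hν1⟩, ht⟩
    exact ⟨ht, e0.2 hν0, e1.2 hν1⟩
  · rintro ⟨ht, hν0, hν1⟩
    exact ⟨⟨ht.1, ht.2.1, e0.1 hν0, e1.1 hν1⟩, ht⟩
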